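/- Let $n\ge 1$ and $1\le k\le n$, let $r,d\ge 1$, and let $\lambda\subseteq\Lambda$ be partitions inside the $k\times(n-k)$ rectangle such that the skew shape $\Lambda/\lambda$ has $rd$ boxes. *Rim hook tableaux.* A rim hook is a nonempty connected skew shape without a $2\times 2$ square; its height $\operatorname{ht}$ is its number of rows minus one. Let $\operatorname{RHT}^r(\Lambda/\lambda)$ be the set of standard $r$-rim hook tableaux of shape $\Lambda/\lambda$, i.e. of sequences of partitions $\lambda=\lambda^{(0)}\subset\lambda^{(1)}\subset\cdots\subset\lambda^{(d)}=\Lambda$ such that every $\lambda^{(i)}/\lambda^{(i-1)}$ is a rim hook with $r$ boxes, and for such a $T$ let $\operatorname{ht}(T)=\sum_i\operatorname{ht}(\lambda^{(i)}/\lambda^{(i-1)})$. Put $\operatorname{sgn}(\Lambda/\lambda)=(-1)^{\operatorname{ht}(T)}$ for any $T\in\operatorname{RHT}^r(\Lambda/\lambda)$, and $\operatorname{sgn}(\Lambda/\lambda)=0$ if $\operatorname{RHT}^r(\Lambda/\lambda)=\varnothing$. *Localized Schubert classes.* For a partition $\mu$ in the rectangle let $w_\mu\in\mathfrak S_n$ be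 the Grassmannian permutation with descent at $k$, given by $w_\mu(k-i+1)=\mu_i+(k-i+1)$ for $1\le i\le k$ and $w_\mu(k+1)<\cdots<w_\mu(n)$. Let $T\subset GL_n$ be the diagonal torus, and use Borel's presentation $$H_T^\bullet(\mathcal{F}\ell(n))=\mathbb Q[x_1,\dots,x_n,t_1,\dots,t_n]/\langle f(x)-f(t): f \text{ symmetric}\rangle ,$$ in which the equivariant Schubert class $[Y(w)]_T$ is represented by the double Schubert polynomial $\mathfrak S_w(x,t)$, where $\mathfrak S_{w_0}=\prod_{i+j\le n}(x_i-t_j)$ and $\mathfrak S_{w}=\partial_i\mathfrak S_{ws_i}$ if $w(i)<w(i+1)$, with $\partial_i f=(f-s_if)/(x_i-x_{i+1})$; localization at the fixed point of $w$ is $f(x,t)|_w=f(t_{w(1)},\dots,t_{w(n)},t_1,\dots,t_n)$. The Schubert class $[Y(\lambda)]_T\in H_T^\bullet(\mathcal{G}r(k,n))\subseteq H_T^\bullet(\mathcal{F}\ell(n))$ is $[Y(w_\lambda)]_T$, and $[Y(\lambda)]_T|_\Lambda=[Y(w_\lambda)]_T|_{w_\Lambda}\in\mathbb Q[t_1,\dots,t_n]$.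 Let $Y_{\lambda,\Lambda}(z)\in\mathbb Q[z]$ be obtained from $[Y(\lambda)]_T|_\Lambda$ by setting $t_i=z^i$ for $1\le i\le n$. **Theorem.** The sign $\operatorname{sgn}(\Lambda/\lambda)$ is well defined (it does not depend on $T$), $Y_{\Lambda,\Lambda}(z)\neq 0$, and $$\frac{Y_{\lambda,\Lambda}(z)}{Y_{\Lambda,\Lambda}(z)}=\frac{1}{(z^r-1)^d}\left(\operatorname{sgn}(\Lambda/\lambda)\,\frac{\#\operatorname{RHT}^r(\Lambda/\lambda)}{r^d\,d!}+o(1)\right),$$ where $o(1)$ stands for some rational function in $\mathbb Q(z)$ that is defined and vanishes at all primitive $r$-th roots of unity. -/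

import Mathlib

open scoped BigOperators

namespace RimHook

noncomputable section

/-! ### Skew shapes, rim hooks and standard rim hook tableaux

Partitions are Mathlib's `YoungDiagram`s: a box is a pair `(i, j)` = (row, column), both counted
from `0`, and containment of diagrams is `≤`. -/

/-- The boxes of the skew shape `ν / μ`. -/
def skewCells (μ ν : YoungDiagram) : Finset (ℕ × ℕ) := ν.cells \ μ.cells

/-- Two boxes are adjacent if they share a side. -/
def cellGraph : SimpleGraph (ℕ × ℕ) where
  Adj p q :=
    (p.1 = q.1 ∧ (p.2 + 1 = q.2 ∨ q.2 + 1 = p.2)) ∨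
      (p.2 = q.2 ∧ (p.1 + 1 = q.1 ∨ q.1 + 1 = p.1))
  symm := ⟨fun p q h => by omega⟩
  loopless := ⟨fun p h => by omega⟩

/-- `ν / μ` is a rim hook (border strip): a connected (in particular nonempty) skew shape that
contains no `2 × 2` square. -/
def IsRimHook (μ ν : YoungDiagram) : Prop :=
  μ ≤ ν ∧ (cellGraph.induce (skewCells μ ν : Set (ℕ × ℕ))).Connected ∧
    ∀ i j : ℕ, ¬ ((i, j) ∈ skewCells μ ν ∧ (i + 1, j) ∈ skewCells μ ν ∧
      (i, j + 1) ∈ skewCells μ ν ∧ (i + 1, j + 1) ∈ skewCells μ ν)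

/-- The height of a rim hook: one less than the number of rows that it meets. -/
def rimHookHeight (μ ν : YoungDiagram) : ℕ := ((skewCells μ ν).image Prod.fst).card - 1

/-- The standard `r`-rim hook tableaux of shape `ν / μ` with `d` rim hooks: the sequences
`μ = T 0 ⊂ T 1 ⊂ ⋯ ⊂ T d = ν` of partitions in which every `T (i+1) / T i` is a rim hook of
size `r`. -/
def RHT (r d : ℕ) (μ ν : YoungDiagram) : Set (Fin (d + 1) → YoungDiagram) :=
  {T | T 0 = μ ∧ T (Fin.last d) = ν ∧
    ∀ i : Fin d, IsRimHook (T i.castSucc) (T i.succ) ∧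
      (skewCells (T i.castSucc) (T i.succ)).card = r}

/-- The height of a rim hook tableau: the sum of the heights of its rim hooks. -/
def tableauHeight {d : ℕ} (T : Fin (d + 1) → YoungDiagram) : ℕ :=
  ∑ i : Fin d, rimHookHeight (T i.castSucc) (T i.succ)

open Classical in
/-- `sgn(ν / μ) = (-1)^{ht(T)}` for a standard `r`-rim hook tableau `T` of shape `ν / μ`, and `0`
if there is none. -/
def skewSign (r d : ℕ) (μ ν : YoungDiagram) : ℤ :=
  if h : (RHT r d μ ν).Nonempty then (-1) ^ tableauHeight h.some else 0

/-! ### Double Schubert polynomials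

Polynomials in `x_1, …, x_n, t_1, …, t_n`: the variable `x_{i+1}` is `X (Sum.inl i)` and `t_{i+1}`
is `X (Sum.inr i)`, for `i : Fin n`. -/

/-- `ℚ[x_1, …, x_n, t_1, …, t_n]`. -/
abbrev XTPoly (n : ℕ) : Type := MvPolynomial (Fin n ⊕ Fin n) ℚ

/-- The exchange of the variables `x_i` and `x_j`. -/
def swapX {n : ℕ} (i j : Fin n) : XTPoly n →ₐ[ℚ] XTPoly n :=
  MvPolynomial.rename (Sum.map (Equiv.swap i j) id)

theorem dvd_sub_swapX {n : ℕ} (i j : Fin n) (f : XTPoly n) :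
    (MvPolynomial.X (Sum.inl i) - MvPolynomial.X (Sum.inl j) : XTPoly n) ∣ f - swapX i j f := by
  rw [← Ideal.mem_span_singleton, ← Ideal.Quotient.eq]
  set I : Ideal (XTPoly n) :=
    Ideal.span {(MvPolynomial.X (Sum.inl i) - MvPolynomial.X (Sum.inl j) : XTPoly n)}
  have hij : Ideal.Quotient.mk I (MvPolynomial.X (Sum.inl i)) =
      Ideal.Quotient.mk I (MvPolynomial.X (Sum.inl j)) :=
    Ideal.Quotient.eq.2 (Ideal.mem_span_singleton_self _)
  have h : Ideal.Quotient.mkₐ ℚ I = (Ideal.Quotient.mkₐ ℚ I).comp (swapX i j) := by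
    apply MvPolynomial.algHom_ext
    rintro (a | a)
    · by_cases hai : a = i
      · subst hai; simpa [swapX] using hij
      · by_cases haj : a = j
        · subst haj; simpa [swapX] using hij.symm
        · simp [swapX, Equiv.swap_apply_of_ne_of_ne hai haj]
    · simp [swapX]
  exact DFunLike.congr_fun h f

/-- The divided difference `(f - s f) / (x_i - x_j)` (for `i ≠ j`), where `s` exchanges `x_i` and
`x_j`. -/
def divDiff {n : ℕ} (i j : Fin n) (f : XTPoly n) : XTPoly n :=
  Classical.choose (dvd_sub_swapX i j f)

theorem divDiff_spec {n : ℕ} (i j : Fin n) (f : XTPoly n) :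
    f - swapX i j f =
      (MvPolynomial.X (Sum.inl i) - MvPolynomial.X (Sum.inl j)) * divDiff i j f :=
  Classical.choose_spec (dvd_sub_swapX i j f)

/-- `w` has an ascent at the (`0`-based) position `i`, i.e. `ℓ(w s) > ℓ(w)` for the adjacent
transposition `s` of the positions `i` and `i + 1`. -/
def IsAscent {n : ℕ} (w : Equiv.Perm (Fin n)) (i : ℕ) : Prop :=
  ∃ h : i + 1 < n, w ⟨i, Nat.lt_of_succ_lt h⟩ < w ⟨i + 1, h⟩

theorem sum_mul_swap_lt {n : ℕ} (w : Equiv.Perm (Fin n)) (i : ℕ) (h : i + 1 < n)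
    (hlt : w ⟨i, Nat.lt_of_succ_lt h⟩ < w ⟨i + 1, h⟩) :
    ∑ a : Fin n, (a : ℕ) *
        ((w * Equiv.swap (⟨i, Nat.lt_of_succ_lt h⟩ : Fin n) ⟨i + 1, h⟩) a : ℕ) <
      ∑ a : Fin n, (a : ℕ) * (w a : ℕ) := by
  set p : Fin n := ⟨i, Nat.lt_of_succ_lt h⟩
  set q : Fin n := ⟨i + 1, h⟩
  have hpq : p ≠ q := by simp [p, q, Fin.ext_iff]
  have hq : q ∈ Finset.univ.erase p := by simp [hpq.symm]
  rw [← Finset.add_sum_erase _ _ (Finset.mem_univ p), ← Finset.add_sum_erase _ _ hq,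
    ← Finset.add_sum_erase _ (fun a : Fin n => (a : ℕ) * (w a : ℕ)) (Finset.mem_univ p),
    ← Finset.add_sum_erase _ (fun a : Fin n => (a : ℕ) * (w a : ℕ)) hq]
  have hrest : ∑ a ∈ (Finset.univ.erase p).erase q, (a : ℕ) * ((w * Equiv.swap p q) a : ℕ) =
      ∑ a ∈ (Finset.univ.erase p).erase q, (a : ℕ) * (w a : ℕ) := by
    refine Finset.sum_congr rfl fun a ha => ?_
    simp only [Finset.mem_erase] at ha
    rw [Equiv.Perm.mul_apply, Equiv.swap_apply_of_ne_of_ne ha.2.1 ha.1]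
  rw [hrest, Equiv.Perm.mul_apply, Equiv.Perm.mul_apply, Equiv.swap_apply_left,
    Equiv.swap_apply_right]
  have h1 : (w p : ℕ) < (w q : ℕ) := hlt
  have h2 : (p : ℕ) = i := rfl
  have h3 : (q : ℕ) = i + 1 := rfl
  rw [h2, h3]
  nlinarith

open Classical in
/-- The double Schubert polynomial `𝔖_w(x, t)`: it is `∏_{i + j ≤ n} (x_i - t_j)` for the longest
permutation (the only one without ascents), and `𝔖_w = ∂_i 𝔖_{w s_i}` if `w` has an ascent at `i`.
The result does not depend on the ascent that is used; here it is the first one. -/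
def doubleSchubert {n : ℕ} (w : Equiv.Perm (Fin n)) : XTPoly n :=
  if h : ∃ i, IsAscent w i then
    have hi : Nat.find h + 1 < n := (Nat.find_spec h).1
    divDiff ⟨Nat.find h, Nat.lt_of_succ_lt hi⟩ ⟨Nat.find h + 1, hi⟩
      (doubleSchubert
        (w * Equiv.swap (⟨Nat.find h, Nat.lt_of_succ_lt hi⟩ : Fin n) ⟨Nat.find h + 1, hi⟩))
  else
    ∏ p : Fin n × Fin n with (p.1 : ℕ) + 1 + ((p.2 : ℕ) + 1) ≤ n,
      (MvPolynomial.X (Sum.inl p.1) - MvPolynomial.X (Sum.inr p.2))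
termination_by ∑ a : Fin n, (a : ℕ) * (w a : ℕ)
decreasing_by
  exact sum_mul_swap_lt w _ _ (Nat.find_spec h).2

/-! ### The `T`-equivariant cohomology of the flag variety, in Borel's presentation -/

/-- The ideal generated by all `f(x) - f(t)` with `f` a symmetric polynomial in `n` variables. -/
def borelIdeal (n : ℕ) : Ideal (XTPoly n) :=
  Ideal.span {g | ∃ f : MvPolynomial (Fin n) ℚ, f.IsSymmetric ∧
    g = MvPolynomial.rename Sum.inl f - MvPolynomial.rename Sum.inr f}

/-- `H_T^•(Fℓ(n)) = ℚ[x, t] / ⟨f(x) - f(t) : f symmetric⟩`, where `x_i` is the equivariant first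
Chern class of the dual of the `i`-th tautological line bundle `𝒱_i / 𝒱_{i-1}`. -/
abbrev EquivCohomologyFl (n : ℕ) : Type := XTPoly n ⧸ borelIdeal n

/-- The equivariant Schubert class `[Y(w)]_T`, the class represented by `𝔖_w(x, t)`. -/
def schubertClass {n : ℕ} (w : Equiv.Perm (Fin n)) : EquivCohomologyFl n :=
  Ideal.Quotient.mk (borelIdeal n) (doubleSchubert w)

/-- The substitution `f(x, t) ↦ f(w t, t)`, i.e. `x_i ↦ t_{w(i)}`. -/
def substPerm {n : ℕ} (w : Equiv.Perm (Fin n)) : XTPoly n →ₐ[ℚ] MvPolynomial (Fin n) ℚ :=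
  MvPolynomial.aeval (Sum.elim (fun i => MvPolynomial.X (w i)) MvPolynomial.X)

theorem substPerm_eq_zero {n : ℕ} (w : Equiv.Perm (Fin n)) (g : XTPoly n)
    (hg : g ∈ borelIdeal n) : substPerm w g = 0 := by
  have hle : borelIdeal n ≤ RingHom.ker (substPerm w) := by
    refine Ideal.span_le.2 ?_
    rintro _ ⟨f, hf, rfl⟩
    have h1 : substPerm w (MvPolynomial.rename Sum.inl f) = MvPolynomial.rename w f := by
      have h : (substPerm w).comp (MvPolynomial.rename Sum.inl) = MvPolynomial.rename w :=
        MvPolynomial.algHom_ext fun i => by simp [substPerm]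
      exact DFunLike.congr_fun h f
    have h2 : substPerm w (MvPolynomial.rename Sum.inr f) = f := by
      rw [substPerm, MvPolynomial.aeval_rename]
      exact MvPolynomial.aeval_X_left_apply f
    simp only [SetLike.mem_coe, RingHom.mem_ker, map_sub, h1, h2]
    rw [hf w, sub_self]
  exact hle hg

/-- The localization `-|_w : H_T^•(Fℓ(n)) → ℚ[t_1, …, t_n]` at the `T`-fixed point of `w`. -/
def localizationAt {n : ℕ} (w : Equiv.Perm (Fin n)) :
    EquivCohomologyFl n →ₐ[ℚ] MvPolynomial (Fin n) ℚ :=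
  Ideal.Quotient.liftₐ (borelIdeal n) (substPerm w) (substPerm_eq_zero w)

/-! ### Grassmannian permutations and localized Schubert classes of the Grassmannian -/

/-- The partitions inside the `k × (n - k)` rectangle. -/
def BoxPartition (k n : ℕ) : Type :=
  {μ : YoungDiagram // ∀ c ∈ μ, c.1 < k ∧ k + c.2 < n}

/-- The values of the Grassmannian permutation `w_μ` with descent at `k`. In `1`-based notation
`w_μ(k - i + 1) = μ_i + (k - i + 1)` for `1 ≤ i ≤ k`, and the last `n - k` values, which are the
remaining ones in increasing order, are `w_μ(k + j) = k + j - μ'_j`, with `μ'` the conjugate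
partition. -/
def grassmannianFun {k n : ℕ} (μ : BoxPartition k n) (a : Fin n) : Fin n :=
  if h : (a : ℕ) < k then
    ⟨a + μ.1.rowLen (k - 1 - a), by
      rcases Nat.eq_zero_or_pos (μ.1.rowLen (k - 1 - a)) with h0 | h0
      · omega
      · have hmem : (k - 1 - (a : ℕ), μ.1.rowLen (k - 1 - a) - 1) ∈ μ.1 :=
          YoungDiagram.mem_iff_lt_rowLen.2 (by omega)
        have := (μ.2 _ hmem).2
        simp only at this
        omega⟩
  else ⟨a - μ.1.colLen (a - k), by omega⟩

theorem grassmannianFun_injective {k n : ℕ} (μ : BoxPartition k n) :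
    Function.Injective (grassmannianFun μ) := by
  have hcol : ∀ j, μ.1.colLen j ≤ k := by
    intro j
    by_contra hcon
    have hmem : (k, j) ∈ μ.1 := YoungDiagram.mem_iff_lt_colLen.2 (by omega)
    have := (μ.2 _ hmem).1
    simp only at this
    omega
  have key : ∀ i j, μ.1.rowLen i + μ.1.colLen j ≠ i + j + 1 := by
    intro i j heq
    by_cases hmem : (i, j) ∈ μ.1
    · have h1 := YoungDiagram.mem_iff_lt_rowLen.1 hmem
      have h2 := YoungDiagram.mem_iff_lt_colLen.1 hmem
      omega
    · have h1 := mt YoungDiagram.mem_iff_lt_rowLen.2 hmem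
      have h2 := mt YoungDiagram.mem_iff_lt_colLen.2 hmem
      omega
  intro a b hab
  have hv := congrArg Fin.val hab
  apply Fin.ext
  unfold grassmannianFun at hv
  by_cases ha : (a : ℕ) < k <;> by_cases hb : (b : ℕ) < k <;>
    simp only [ha, hb, dif_pos, dif_neg, not_false_iff] at hv
  · rcases lt_trichotomy (a : ℕ) b with h | h | h
    · have := μ.1.rowLen_anti (k - 1 - b) (k - 1 - a) (by omega)
      omega
    · exact h
    · have := μ.1.rowLen_anti (k - 1 - a) (k - 1 - b) (by omega)
      omega
  · have h1 := key (k - 1 - a) (b - k)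
    have h2 := hcol (b - k)
    omega
  · have h1 := key (k - 1 - b) (a - k)
    have h2 := hcol (a - k)
    omega
  · have h1 := hcol (a - k)
    have h2 := hcol (b - k)
    rcases lt_trichotomy (a : ℕ) b with h | h | h
    · have := μ.1.colLen_anti (a - k) (b - k) (by omega)
      omega
    · exact h
    · have := μ.1.colLen_anti (b - k) (a - k) (by omega)
      omega

/-- The Grassmannian permutation `w_μ ∈ 𝔖_n` with descent at `k`. -/
def grassmannianPerm {k n : ℕ} (μ : BoxPartition k n) : Equiv.Perm (Fin n) :=
  Equiv.ofBijective (grassmannianFun μ)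
    (Finite.injective_iff_bijective.1 (grassmannianFun_injective μ))

/-- The localization `[Y(μ)]_T|_ν ∈ ℚ[t_1, …, t_n]` of the Schubert class of the Grassmannian
`Gr(k, n)`; here `H_T^•(Gr(k, n))` is regarded as a subring of `H_T^•(Fℓ(n))` by the pullback, under
which `[Y(μ)]_T = [Y(w_μ)]_T` and `-|_ν` is the restriction of `-|_{w_ν}`. -/
def localizedClass {k n : ℕ} (μ ν : BoxPartition k n) : MvPolynomial (Fin n) ℚ :=
  localizationAt (grassmannianPerm ν) (schubertClass (grassmannianPerm μ))

/-- `Y_{μ,ν}(z)`: the specialization `t_i = z^i` (`1 ≤ i ≤ n`) of `[Y(μ)]_T|_ν`. -/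
def localizedPoly {k n : ℕ} (μ ν : BoxPartition k n) : Polynomial ℚ :=
  MvPolynomial.aeval (fun i : Fin n => (Polynomial.X : Polynomial ℚ) ^ ((i : ℕ) + 1))
    (localizedClass μ ν)

/-- `g = o(1)`: the rational function `g ∈ ℚ(z)` is defined and vanishes at all primitive `r`-th
roots of unity. -/
def IsLittleO (r : ℕ) (g : RatFunc ℚ) : Prop :=
  ∀ ζ : ℂ, IsPrimitiveRoot ζ r →
    Polynomial.aeval ζ g.denom ≠ 0 ∧ Polynomial.aeval ζ g.num = 0

end

end RimHook

/-! A localized Grassmannian Schubert class is a factorial Schur function, hence a ratio of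
alternants. Put `y_j = z^(j+1)`, `(x|y)^m = ∏_{j<m} (x - y_j)`, let `B` be the beta numbers of `Λ`,
and for an exponent vector `μ` let `A_μ = det ((y_{B_a} | y)^{μ_i})`. By
`exists_schubertValue_mul_eq_det`, the value of `[Y(λ)]` at `Λ`, times a factor that depends only on
`Λ`, is `A_μ` for `μ` the beta numbers of `λ`. That factor cancels in the quotient. For `λ = Λ` only
the identity permutation contributes to the determinant, which is then a nonzero product `D`; this
also gives the nonvanishing.

Expanding `x^r (x|y)^m` in factorial powers yields a Pieri rule for the `r`-th power sum, `(∑_j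
y_{B_j}^r - ∑_j y_{μ_j}^r) A_μ = ∑_j ∑_{1≤s≤r} z^((μ_j+1)(r-s)) [r choose s]_z A_{μ + s e_j}`. The
factor on the left is `(z^r - 1) U`, where `U` takes the value `m = |B| - |μ|` at a primitive `r`-th
root of unity `ζ`. For `0 < s < r` the `q`-binomial is itself divisible by `z^r - 1` near `ζ`.
Induction on `m` (`exists_hasVal_alternant`) shows that `(z^r - 1)^⌊m/r⌋ A_μ / D` is regular at `ζ`.
If `m = r d`, only `s = r` matters at leading order, and each step contributes a factor `1/(r d)`;
so the value is `N / (r^d d!)`, with `N` the signed number of ways to reach a rearrangement of `B`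
by adding `r` to one entry `d` times.

Adding an `r`-rim hook adds `r` to one beta number and re-sorts by a cycle of sign `(-1)^ht`;
vectors with a repeated entry contribute zero by antisymmetry. Thus `N` is the signed number of rim
hook tableaux. The sign is constant because sorting by residue modulo `r`, then by size, is
undisturbed when `r` is added to an entry without collision: `(-1)^ht(T)` is the product of the
sorting signs of the two end shapes (`neg_one_pow_tableauHeight`). -/

namespace RimHook

open Equiv

/-! ### Divided differences on the orbit of a point, and independence of the chosen ascent -/

/-- The divided difference at the positions `p`, `q` of a function on `𝔖_n`, where the variable at
position `i` takes the value `y (v i)` at the permutation `v`. -/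
def permDivDiff {n : ℕ} {K : Type*} [Field K] (y : Fin n → K) (p q : Fin n)
    (φ : Perm (Fin n) → K) (v : Perm (Fin n)) : K :=
  (φ v - φ (v * swap p q)) / (y (v p) - y (v q))

theorem permDivDiff_comm {n : ℕ} {K : Type*} [Field K] (y : Fin n → K) {p q p' q' : Fin n}
    (h1 : p ≠ p') (h2 : p ≠ q') (h3 : q ≠ p') (h4 : q ≠ q') (φ : Perm (Fin n) → K) :
    permDivDiff y p q (permDivDiff y p' q' φ) = permDivDiff y p' q' (permDivDiff y p q φ) := by
  funext v
  have hc : swap p q * swap p' q' = swap p' q' * swap p q := by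
    ext x
    simp only [Perm.mul_apply, swap_apply_def]
    split_ifs <;> simp_all
  simp only [permDivDiff, Perm.mul_apply, swap_apply_of_ne_of_ne h1.symm h3.symm,
    swap_apply_of_ne_of_ne h2.symm h4.symm, swap_apply_of_ne_of_ne h1 h2,
    swap_apply_of_ne_of_ne h3 h4, mul_assoc, hc]
  ring

theorem swap_braid {α : Type*} [DecidableEq α] {p q r : α} (hpq : p ≠ q) (hqr : q ≠ r)
    (hpr : p ≠ r) :
    swap p q * (swap q r * swap p q) = swap q r * (swap p q * swap q r) := by
  ext x
  simp only [Perm.mul_apply, swap_apply_def]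
  split_ifs <;> simp_all

/-- Both sides are the alternating sum of `φ` over the six permutations of the three positions,
divided by the product of the three differences. -/
theorem permDivDiff_braid {n : ℕ} {K : Type*} [Field K] {y : Fin n → K}
    (hy : Function.Injective y) {p q r : Fin n} (hpq : p ≠ q) (hqr : q ≠ r) (hpr : p ≠ r)
    (φ : Perm (Fin n) → K) :
    permDivDiff y p q (permDivDiff y q r (permDivDiff y p q φ)) =
      permDivDiff y q r (permDivDiff y p q (permDivDiff y q r φ)) := by
  funext v
  have h1 : y (v p) - y (v q) ≠ 0 := sub_ne_zero.2 fun h => hpq (v.injective (hy h))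
  have h2 : y (v q) - y (v r) ≠ 0 := sub_ne_zero.2 fun h => hqr (v.injective (hy h))
  have h3 : y (v p) - y (v r) ≠ 0 := sub_ne_zero.2 fun h => hpr (v.injective (hy h))
  have h1' : y (v q) - y (v p) ≠ 0 := by rwa [← neg_sub, neg_ne_zero]
  have h2' : y (v r) - y (v q) ≠ 0 := by rwa [← neg_sub, neg_ne_zero]
  have h3' : y (v r) - y (v p) ≠ 0 := by rwa [← neg_sub, neg_ne_zero]
  simp only [permDivDiff, Perm.mul_apply, swap_apply_of_ne_of_ne hpr.symm hqr.symm,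
    swap_apply_of_ne_of_ne hpq hpr, swap_apply_left, swap_apply_right, mul_assoc,
    swap_braid hpq hqr hpr, swap_mul_self, mul_one]
  generalize y (v p) = a at *
  generalize y (v q) = b at *
  generalize y (v r) = c at *
  field_simp
  ring

theorem permDivDiff_mul_swap {n : ℕ} {K : Type*} [Field K] (y : Fin n → K) (p q : Fin n)
    (φ : Perm (Fin n) → K) (v : Perm (Fin n)) :
    permDivDiff y p q φ (v * swap p q) = permDivDiff y p q φ v := by
  simp only [permDivDiff, Perm.mul_apply, swap_apply_left, swap_apply_right, mul_assoc,
    swap_mul_self, mul_one]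
  rw [← neg_sub (φ v), ← neg_sub (y (v p)), neg_div_neg_eq]

/-- The value of `𝔖_u(x, t)` at `x_i = y (v i)` and `t = y`. -/
noncomputable def schubertValue {n : ℕ} {K : Type*} [Field K] [Algebra ℚ K] (y : Fin n → K)
    (u v : Perm (Fin n)) : K :=
  MvPolynomial.aeval (Sum.elim (fun i => y (v i)) y) (doubleSchubert u)

/-- Exchanging two `x`-variables multiplies the evaluation point by a transposition on the right.
Injectivity of `y` keeps the denominator nonzero, so division of polynomials becomes division of
values. -/
theorem aeval_divDiff {n : ℕ} {K : Type*} [Field K] [Algebra ℚ K] {y : Fin n → K}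
    (hy : Function.Injective y) {p q : Fin n} (hpq : p ≠ q) (f : XTPoly n) (v : Perm (Fin n)) :
    MvPolynomial.aeval (Sum.elim (fun i => y (v i)) y) (divDiff p q f) =
      permDivDiff y p q (fun v => MvPolynomial.aeval (Sum.elim (fun i => y (v i)) y) f) v := by
  have h1 : y (v p) - y (v q) ≠ 0 := sub_ne_zero.2 fun h => hpq (v.injective (hy h))
  have h := congrArg (MvPolynomial.aeval (Sum.elim (fun i => y (v i)) y)) (divDiff_spec p q f)
  have hs : MvPolynomial.aeval (Sum.elim (fun i => y (v i)) y) (swapX p q f) =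
      MvPolynomial.aeval (Sum.elim (fun i => y ((v * swap p q) i)) y) f := by
    rw [swapX, MvPolynomial.aeval_rename]
    congr 2
    funext i
    cases i <;> simp
  simp only [map_sub, map_mul, MvPolynomial.aeval_X, Sum.elim_inl, hs] at h
  rw [permDivDiff, h, mul_div_cancel_left₀ _ h1]

theorem doubleSchubert_of_exists_isAscent {n : ℕ} (w : Perm (Fin n)) (h : ∃ i, IsAscent w i) :
    ∃ (p q : Fin n), (p : ℕ) + 1 = q ∧ w p < w q ∧
      (∀ p' q' : Fin n, (p' : ℕ) + 1 = q' → p' < p → w q' < w p') ∧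
      doubleSchubert w = divDiff p q (doubleSchubert (w * swap p q)) := by
  classical
  have hi : Nat.find h + 1 < n := (Nat.find_spec h).1
  refine ⟨⟨Nat.find h, Nat.lt_of_succ_lt hi⟩, ⟨Nat.find h + 1, hi⟩, rfl, (Nat.find_spec h).2,
    ?_, ?_⟩
  · intro p' q' hpq' hlt
    have hna := Nat.find_min h (m := p') hlt
    by_contra hcon
    have hne : w p' ≠ w q' := fun he => by
      have := congrArg Fin.val (w.injective he)
      omega
    refine hna ⟨by omega, ?_⟩
    have hq : (⟨(p' : ℕ) + 1, by omega⟩ : Fin n) = q' := Fin.ext hpq'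
    simp only [hq]
    exact lt_of_le_of_ne (not_lt.1 hcon) hne
  · rw [doubleSchubert, dif_pos h]

theorem sum_mul_swap_lt' {n : ℕ} (w : Perm (Fin n)) {p q : Fin n} (hpq : (p : ℕ) + 1 = q)
    (hlt : w p < w q) :
    ∑ a : Fin n, (a : ℕ) * ((w * swap p q) a : ℕ) < ∑ a : Fin n, (a : ℕ) * (w a : ℕ) := by
  obtain ⟨p, hp⟩ := p
  obtain ⟨q, hq⟩ := q
  obtain rfl : p + 1 = q := hpq
  exact sum_mul_swap_lt w p hq hlt

/-- The definition uses the first ascent; the commutation and braid relations, with induction on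
longer permutations, allow any ascent. The statistic `∑ a * u a` drops at each exchange of an ascent
and so serves as the induction measure. -/
theorem schubertValue_eq_permDivDiff {n : ℕ} {K : Type*} [Field K] [Algebra ℚ K] {y : Fin n → K}
    (hy : Function.Injective y) (u : Perm (Fin n)) {p q : Fin n} (hpq : (p : ℕ) + 1 = q)
    (hlt : u p < u q) :
    schubertValue y u = permDivDiff y p q (schubertValue y (u * swap p q)) := by
  induction hN : ∑ a : Fin n, (a : ℕ) * (u a : ℕ) using Nat.strong_induction_on
    generalizing u p q with
  | _ N ih =>
  subst hN
  have hex : ∃ i, IsAscent u i := by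
    refine ⟨p, by omega, ?_⟩
    have : (⟨(p : ℕ) + 1, by omega⟩ : Fin n) = q := Fin.ext hpq
    rw [this]; exact hlt
  obtain ⟨a, b, hab, hlt', hfirst, hdef⟩ := doubleSchubert_of_exists_isAscent u hex
  have hne : ∀ {c d : Fin n}, (c : ℕ) ≠ d → c ≠ d := fun h he => h (congrArg Fin.val he)
  have hstep : schubertValue y u = permDivDiff y a b (schubertValue y (u * swap a b)) := by
    funext v
    rw [schubertValue, hdef, aeval_divDiff hy (hne (by omega))]
    rfl
  have hab_lt := sum_mul_swap_lt' u hab hlt'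
  have hpq_lt := sum_mul_swap_lt' u hpq hlt
  rcases lt_trichotomy (a : ℕ) p with hap | hap | hap
  -- Overlapping ascents are related by the braid relation, disjoint ones by commutation.
  · by_cases hbp : b = p
    · subst hbp
      have e1 : a ≠ b := hne (by omega)
      have e2 : b ≠ q := hne (by omega)
      have e3 : a ≠ q := hne (by omega)
      have l1 : (u * swap a b) b < (u * swap a b) q := by
        simp only [Perm.mul_apply, swap_apply_right, swap_apply_of_ne_of_ne e3.symm e2.symm]
        exact hlt'.trans hlt
      have l2 : (u * swap a b * swap b q) a < (u * swap a b * swap b q) b := by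
        simp only [Perm.mul_apply, swap_apply_left, swap_apply_of_ne_of_ne e3.symm e2.symm,
          swap_apply_of_ne_of_ne e1 e3]
        exact hlt
      have l3 : (u * swap b q) a < (u * swap b q) b := by
        simp only [Perm.mul_apply, swap_apply_left, swap_apply_of_ne_of_ne e1 e3]
        exact hlt'.trans hlt
      have l4 : (u * swap b q * swap a b) b < (u * swap b q * swap a b) q := by
        simp only [Perm.mul_apply, swap_apply_right, swap_apply_of_ne_of_ne e3.symm e2.symm,
          swap_apply_of_ne_of_ne e1 e3]
        exact hlt'
      rw [hstep, ih _ hab_lt _ hpq l1 rfl,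
        ih _ ((sum_mul_swap_lt' _ hpq l1).trans hab_lt) _ hab l2 rfl, permDivDiff_braid hy e1 e2 e3,
        ih _ hpq_lt _ hab l3 rfl, ih _ ((sum_mul_swap_lt' _ hab l3).trans hpq_lt) _ hpq l4 rfl]
      simp only [mul_assoc, swap_braid e1 e2 e3]
    · have e1 : a ≠ p := hne (by omega)
      have e2 : a ≠ q := hne (by omega)
      have e4 : b ≠ q := hne (by omega)
      have l1 : (u * swap a b) p < (u * swap a b) q := by
        simp only [Perm.mul_apply, swap_apply_of_ne_of_ne e1.symm (Ne.symm hbp),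
          swap_apply_of_ne_of_ne e2.symm e4.symm]
        exact hlt
      have l2 : (u * swap p q) a < (u * swap p q) b := by
        simp only [Perm.mul_apply, swap_apply_of_ne_of_ne e1 e2, swap_apply_of_ne_of_ne hbp e4]
        exact hlt'
      have hc : swap a b * swap p q = swap p q * swap a b := by
        ext x
        simp only [Perm.mul_apply, swap_apply_def]
        split_ifs <;> simp_all
      rw [hstep, ih _ hab_lt _ hpq l1 rfl, permDivDiff_comm y e1 e2 hbp e4,
        ih _ hpq_lt _ hab l2 rfl]
      simp only [mul_assoc, hc]
  · obtain rfl : a = p := Fin.ext hap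
    obtain rfl : b = q := Fin.ext (by omega)
    exact hstep
  · exact absurd (hfirst p q hpq hap) (not_lt.2 hlt.le)

theorem schubertValue_mul_swap {n : ℕ} {K : Type*} [Field K] [Algebra ℚ K] {y : Fin n → K}
    (hy : Function.Injective y) (u : Perm (Fin n)) {p q : Fin n} (hpq : (p : ℕ) + 1 = q)
    (hlt : u p < u q) (v : Perm (Fin n)) :
    schubertValue y u (v * swap p q) = schubertValue y u v := by
  rw [schubertValue_eq_permDivDiff hy u hpq hlt, permDivDiff_mul_swap]

/-! ### Lehmer codes and dominant permutations -/

/-- The Lehmer code of a sequence. -/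
def code {m : ℕ} (g : Fin m → ℕ) (i : Fin m) : ℕ :=
  (Finset.univ.filter fun j => i < j ∧ g j < g i).card

theorem code_le {m : ℕ} (g : Fin m → ℕ) (i : Fin m) : code g i ≤ m - 1 - i := by
  rw [← Fin.card_Ioi]
  exact Finset.card_le_card fun j hj => by simpa using (Finset.mem_filter.1 hj).2.1

theorem code_of_strictAnti {m : ℕ} {g : Fin m → ℕ} (hg : StrictAnti g) (i : Fin m) :
    code g i = m - 1 - i := by
  rw [← Fin.card_Ioi, code]
  congr 1
  ext j
  simp only [Finset.mem_filter, Finset.mem_univ, true_and, Finset.mem_Ioi]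
  exact ⟨fun h => h.1, fun h => ⟨h, hg h⟩⟩

theorem code_of_strictMono {m : ℕ} {g : Fin m → ℕ} (hg : StrictMono g) (i : Fin m) :
    code g i = 0 := by
  rw [code, Finset.card_eq_zero, Finset.filter_eq_empty_iff]
  exact fun j _ h => (hg h.1).not_gt h.2

theorem strictAnti_or_exists_first_ascent {m : ℕ} {g : Fin m → ℕ} (hg : Function.Injective g) :
    StrictAnti g ∨ ∃ p q : Fin m, (p : ℕ) + 1 = q ∧ g p < g q ∧
      ∀ p' q' : Fin m, (p' : ℕ) + 1 = q' → p' < p → g q' < g p' := by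
  have step : ∀ p q : Fin m, (p : ℕ) + 1 = q → ¬ g p < g q → g q < g p := by
    intro p q hpq h
    refine lt_of_le_of_ne (not_lt.1 h) fun he => ?_
    have := congrArg Fin.val (hg he)
    omega
  by_cases hex : ∃ p q : Fin m, (p : ℕ) + 1 = q ∧ g p < g q
  · right
    obtain ⟨p, ⟨q, hpq, hlt⟩, hmin⟩ := WellFounded.has_min (wellFounded_lt (α := Fin m))
      {p | ∃ q : Fin m, (p : ℕ) + 1 = q ∧ g p < g q} hex
    exact ⟨p, q, hpq, hlt, fun p' q' h h' =>
      step p' q' h fun hl => hmin p' ⟨q', h, hl⟩ h'⟩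
  · left
    push Not at hex
    have key : ∀ t : ℕ, ∀ a b : Fin m, (a : ℕ) + t + 1 = b → g b < g a := by
      intro t
      induction t with
      | zero => exact fun a b h => step a b (by omega) (not_lt.2 (hex a b (by omega)))
      | succ t ih =>
        intro a b h
        have h1 := ih a ⟨a + t + 1, by omega⟩ rfl
        have hs : ((⟨a + t + 1, by omega⟩ : Fin m) : ℕ) + 1 = b := by
          simp only
          omega
        exact (step _ b hs (not_lt.2 (hex _ b hs))).trans h1
    intro a b hab
    exact key (b - a - 1) a b (by have : (a : ℕ) < b := hab; omega)

theorem code_comp_swap {m : ℕ} (g : Fin m → ℕ) {p q : Fin m} (hpq : (p : ℕ) + 1 = q)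
    (hlt : g p < g q) (hc : code g p = code g q) :
    code (g ∘ swap p q) = Function.update (code g) p (code g p + 1) := by
  have hne : p ≠ q := fun h => by rw [h] at hpq; omega
  funext i
  by_cases hip : i = p
  · subst hip
    rw [Function.update_self, hc, code, code,
      ← Finset.card_insert_of_notMem (a := i) (by simp [hlt, Fin.lt_def, -Fin.val_fin_lt]; omega)]
    refine Finset.card_equiv (swap i q) fun j => ?_
    by_cases hj : j = i
    · subst hj; simp [hne.symm]
    · by_cases hj' : j = q
      · subst hj'; simp [Fin.lt_def, -Fin.val_fin_lt, ← hpq, hlt]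
      · have h1 : (j : ℕ) ≠ i := fun h => hj (Fin.ext h)
        have h2 : (j : ℕ) ≠ q := fun h => hj' (Fin.ext h)
        simp [swap_apply_of_ne_of_ne hj hj', hj, Fin.lt_def, -Fin.val_fin_lt]
        omega
  · rw [Function.update_of_ne hip]
    by_cases hiq : i = q
    · subst hiq
      rw [← hc, code, code]
      refine Finset.card_equiv (swap p i) fun j => ?_
      by_cases hj : j = i
      · subst hj; simp
      · by_cases hj' : j = p
        · subst hj'; simp [Fin.lt_def, -Fin.val_fin_lt, ← hpq]; omega
        · have h1 : (j : ℕ) ≠ i := fun h => hj (Fin.ext h)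
          have h2 : (j : ℕ) ≠ p := fun h => hj' (Fin.ext h)
          simp [swap_apply_of_ne_of_ne hj' hj, Fin.lt_def, -Fin.val_fin_lt]
          omega
    · have h3 : (i : ℕ) ≠ p := fun h => hip (Fin.ext h)
      have h4 : (i : ℕ) ≠ q := fun h => hiq (Fin.ext h)
      rw [code, code]
      refine Finset.card_equiv (swap p q) fun j => ?_
      by_cases hj : j = p
      · subst hj
        simp [swap_apply_of_ne_of_ne hip hiq, Fin.lt_def, -Fin.val_fin_lt]
        omega
      · by_cases hj' : j = q
        · subst hj'
          simp [swap_apply_of_ne_of_ne hip hiq, Fin.lt_def, -Fin.val_fin_lt]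
          omega
        · simp [swap_apply_of_ne_of_ne hip hiq, swap_apply_of_ne_of_ne hj hj']

/-- An ascent forces the code to increase weakly, since every later value below `g p` is also below
`g q`; antitonicity gives the reverse inequality. -/
theorem code_eq_of_antitone {m : ℕ} {g : Fin m → ℕ} (ha : Antitone (code g)) {p q : Fin m}
    (hpq : (p : ℕ) + 1 = q) (hlt : g p < g q) : code g p = code g q := by
  refine le_antisymm (Finset.card_le_card fun j hj => ?_) (ha (Fin.le_def.2 (by omega)))
  simp only [Finset.mem_filter, Finset.mem_univ, true_and] at hj ⊢
  refine ⟨?_, hj.2.trans hlt⟩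
  have hjq : j ≠ q := fun h => by
    subst h
    exact hj.2.not_gt hlt
  have h1 : (j : ℕ) ≠ q := fun h => hjq (Fin.ext h)
  have h2 : (p : ℕ) < j := hj.1
  rw [Fin.lt_def]
  omega

/-- The exchange raises the code at `p` by one, which could only break the comparison with `p - 1`.
As `p` is the first ascent, `p - 1` is a descent and its code already exceeds that of `p`. -/
theorem antitone_code_comp_swap {m : ℕ} {g : Fin m → ℕ} (ha : Antitone (code g)) {p q : Fin m}
    (hpq : (p : ℕ) + 1 = q) (hlt : g p < g q)
    (hfirst : ∀ p' q' : Fin m, (p' : ℕ) + 1 = q' → p' < p → g q' < g p') :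
    Antitone (code (g ∘ swap p q)) := by
  rw [code_comp_swap g hpq hlt (code_eq_of_antitone ha hpq hlt)]
  intro a b hab
  by_cases hb : b = p
  · subst hb
    by_cases hba : a = b
    · rw [hba]
    · have h1 : (a : ℕ) < b := lt_of_le_of_ne hab fun h => hba (Fin.ext h)
      have h2 : ((⟨b - 1, by omega⟩ : Fin m) : ℕ) + 1 = b := by
        simp only
        omega
      have h3 := hfirst _ b h2 (Fin.lt_def.2 (by omega))
      -- The inversions of `b`, together with `b` itself, are inversions of `b - 1`.
      have h4 : code g b + 1 ≤ code g ⟨b - 1, by omega⟩ := by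
        rw [code, code, ← Finset.card_insert_of_notMem (a := b) (by simp)]
        refine Finset.card_le_card fun j hj => ?_
        simp only [Finset.mem_insert, Finset.mem_filter, Finset.mem_univ, true_and,
          Fin.lt_def] at hj ⊢
        rcases hj with rfl | hj
        · exact ⟨by omega, h3⟩
        · exact ⟨by omega, hj.2.trans h3⟩
      rw [Function.update_self, Function.update_of_ne hba]
      exact h4.trans (ha (Fin.le_def.2 (by simp only; omega)))
  · rw [Function.update_of_ne hb]
    by_cases hap : a = p
    · subst hap
      rw [Function.update_self]
      exact (ha hab).trans (Nat.le_succ _)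
    · rw [Function.update_of_ne hap]
      exact ha hab

/-- The factorial power `(x | y)^m`. -/
def newton {K : Type*} [CommRing K] (y : ℕ → K) (x : K) (m : ℕ) : K :=
  ∏ j ∈ Finset.range m, (x - y j)

theorem newton_succ {K : Type*} [CommRing K] (y : ℕ → K) (x : K) (m : ℕ) :
    newton y x (m + 1) = newton y x m * (x - y m) :=
  Finset.prod_range_succ _ _

theorem newton_zero {K : Type*} [CommRing K] (y : ℕ → K) (x : K) : newton y x 0 = 1 :=
  Finset.prod_range_zero _

theorem prod_filter_lt_eq_newton {K : Type*} [CommRing K] (y : ℕ → K) (x : K) {m n : ℕ}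
    (h : m ≤ n) : ∏ j : Fin n, (if (j : ℕ) < m then x - y j else 1) = newton y x m := by
  rw [← Finset.prod_range (n := n) (fun j => if j < m then x - y j else 1), newton,
    ← Finset.prod_filter]
  congr 1
  ext j
  simp only [Finset.mem_filter, Finset.mem_range]
  omega

theorem prod_update_newton {m : ℕ} {K : Type*} [CommRing K] (y : ℕ → K) (x : Fin m → K)
    (c : Fin m → ℕ) (p : Fin m) :
    ∏ i, newton y (x i) (Function.update c p (c p + 1) i) =
      (x p - y (c p)) * ∏ i, newton y (x i) (c i) := by
  rw [← Finset.mul_prod_erase _ _ (Finset.mem_univ p),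
    ← Finset.mul_prod_erase _ (fun i => newton y (x i) (c i)) (Finset.mem_univ p),
    Function.update_self, newton_succ]
  have : ∏ i ∈ Finset.univ.erase p, newton y (x i) (Function.update c p (c p + 1) i) =
      ∏ i ∈ Finset.univ.erase p, newton y (x i) (c i) :=
    Finset.prod_congr rfl fun i hi => by rw [Function.update_of_ne (Finset.ne_of_mem_erase hi)]
  rw [this]
  ring

theorem prod_comp_swap_eq {m : ℕ} {K M : Type*} [CommMonoid M] (F : K → ℕ → M) (x : Fin m → K)
    (c : Fin m → ℕ) {p q : Fin m} (hc : c p = c q) :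
    ∏ i, F (x (swap p q i)) (c i) = ∏ i, F (x i) (c i) := by
  rw [← Equiv.prod_comp (swap p q)]
  refine Finset.prod_congr rfl fun i _ => ?_
  rw [swap_apply_self]
  congr 1
  rw [swap_apply_def]
  split_ifs <;> simp_all

/-- The double Schubert polynomial of a dominant permutation is a product over its diagram. -/
theorem schubertValue_of_antitone_code {n : ℕ} {K : Type*} [Field K] [Algebra ℚ K] {y : ℕ → K}
    (hy : Function.Injective fun i : Fin n => y i) (u : Perm (Fin n))
    (hu : Antitone (code fun i => (u i : ℕ))) (v : Perm (Fin n)) :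
    schubertValue (fun i : Fin n => y i) u v =
      ∏ i, newton y (y (v i)) (code (fun i => (u i : ℕ)) i) := by
  induction hN : ∑ a : Fin n, (a : ℕ) * (u a : ℕ) using Nat.strong_induction_on
    generalizing u v with
  | _ N ih =>
  subst hN
  have hinj : Function.Injective fun i => (u i : ℕ) :=
    fun a b h => u.injective (Fin.ext h)
  rcases strictAnti_or_exists_first_ascent hinj with hanti | ⟨p, q, hpq, hlt, hfirst⟩
  · have hex : ¬ ∃ i, IsAscent u i := by
      rintro ⟨i, hi, hlt⟩
      exact (hanti (show (⟨i, Nat.lt_of_succ_lt hi⟩ : Fin n) < ⟨i + 1, hi⟩ from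
        Fin.lt_def.2 (Nat.lt_succ_self i))).not_gt hlt
    rw [schubertValue, doubleSchubert, dif_neg hex, map_prod, Finset.prod_filter,
      Fintype.prod_prod_type]
    refine Finset.prod_congr rfl fun i _ => ?_
    rw [code_of_strictAnti hanti, ← prod_filter_lt_eq_newton y (y (v i)) (n := n) (by omega)]
    refine Finset.prod_congr rfl fun j _ => ?_
    simp only [map_sub, MvPolynomial.aeval_X, Sum.elim_inl, Sum.elim_inr]
    refine if_congr ?_ rfl rfl
    omega
  · have hne : p ≠ q := fun h => by rw [h] at hpq; omega
    have hc := code_eq_of_antitone hu hpq hlt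
    have hv : y (v p) - y (v q) ≠ 0 := sub_ne_zero.2 fun h => hne (v.injective (hy h))
    have hcode := code_comp_swap _ hpq hlt hc
    have ih' := fun v => ih _ (sum_mul_swap_lt' u hpq hlt) (u * swap p q)
      (antitone_code_comp_swap hu hpq hlt hfirst) v rfl
    have hcode' : code (fun i => ((u * swap p q) i : ℕ)) = _ := hcode
    rw [schubertValue_eq_permDivDiff hy u hpq hlt, permDivDiff, ih', ih', hcode',
      prod_update_newton, prod_update_newton]
    -- The equal exponents at `p` and `q` make the product symmetric there, so the divided
    -- difference acts only on the extra factor `x_p - y_{c_p}` and turns it into `1`.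
    have hsw := prod_comp_swap_eq (newton y) (fun i => y (v i)) _ hc
    simp only [Perm.mul_apply, swap_apply_left] at hsw ⊢
    rw [hsw, div_eq_iff hv]
    ring

/-! ### Antisymmetrization over the first `k` positions -/

/-- The permutations of the first `k` positions, as permutations of all `n` positions. -/
noncomputable def permExt {k n : ℕ} (h : k ≤ n) : Perm (Fin k) →* Perm (Fin n) :=
  Perm.viaEmbeddingHom (Fin.castLEEmb h)

theorem permExt_castLE {k n : ℕ} (h : k ≤ n) (σ : Perm (Fin k)) (i : Fin k) :
    permExt h σ (Fin.castLE h i) = Fin.castLE h (σ i) :=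
  Perm.viaEmbedding_apply σ (Fin.castLEEmb h) i

theorem permExt_of_le {k n : ℕ} (h : k ≤ n) (σ : Perm (Fin k)) {i : Fin n} (hi : k ≤ i) :
    permExt h σ i = i := by
  refine Perm.viaEmbedding_apply_of_notMem σ (Fin.castLEEmb h) i ?_
  rintro ⟨a, rfl⟩
  have := a.2
  simp at hi
  omega

theorem permExt_swap {k n : ℕ} (h : k ≤ n) (p q : Fin k) :
    permExt h (swap p q) = swap (Fin.castLE h p) (Fin.castLE h q) := by
  refine Equiv.ext fun i => ?_
  by_cases hi : (i : ℕ) < k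
  · obtain ⟨a, rfl⟩ : ∃ a, Fin.castLE h a = i := ⟨⟨i, hi⟩, rfl⟩
    rw [permExt_castLE, (Fin.castLE_injective h).map_swap]
  · rw [permExt_of_le h _ (not_lt.1 hi), swap_apply_of_ne_of_ne]
    · rintro rfl; exact hi p.2
    · rintro rfl; exact hi q.2

/-- The alternating sum of `φ` over a coset of the permutations of the first `k` positions. -/
noncomputable def alt {k n : ℕ} {K : Type*} [Field K] (h : k ≤ n) (v : Perm (Fin n))
    (φ : Perm (Fin n) → K) : K :=
  ∑ σ : Perm (Fin k), ((Perm.sign σ : ℤ) : K) * φ (v * permExt h σ)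

theorem alt_mul_swap {k n : ℕ} {K : Type*} [Field K] (h : k ≤ n) (v : Perm (Fin n))
    (φ : Perm (Fin n) → K) {p q : Fin k} (hpq : p ≠ q) :
    alt h v (fun w => φ (w * swap (Fin.castLE h p) (Fin.castLE h q))) = - alt h v φ := by
  rw [alt, alt, ← Equiv.sum_comp (Equiv.mulRight (swap p q)), ← Finset.sum_neg_distrib]
  refine Finset.sum_congr rfl fun σ _ => ?_
  simp [Perm.sign_mul, Perm.sign_swap hpq, permExt_swap, mul_assoc]

/-- Antisymmetrization trades a divided difference for a variable. With `η` and `∂φ` symmetric under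
the exchange `s`, one has `x_p η ∂φ - s(x_p η ∂φ) = η (x_p - x_q) ∂φ = ηφ - s(ηφ)`; the alternating
sum doubles each side, and `2` is cancelled. -/
theorem alt_mul_permDivDiff {k n : ℕ} {K : Type*} [Field K] [CharZero K] (h : k ≤ n)
    {y : Fin n → K} (hy : Function.Injective y) (v : Perm (Fin n)) (φ η : Perm (Fin n) → K)
    {p q : Fin k} (hpq : p ≠ q)
    (hη : ∀ w, η (w * swap (Fin.castLE h p) (Fin.castLE h q)) = η w) :
    alt h v (fun w => y (w (Fin.castLE h p)) * η w *
      permDivDiff y (Fin.castLE h p) (Fin.castLE h q) φ w) = alt h v (fun w => η w * φ w) := by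
  set g : Perm (Fin n) → K := fun w => y (w (Fin.castLE h p)) * η w *
      permDivDiff y (Fin.castLE h p) (Fin.castLE h q) φ w with hg
  have h1 := alt_mul_swap h v g hpq
  have h2 := alt_mul_swap h v (fun w => η w * φ w) hpq
  have h3 : alt h v g - alt h v (fun w => g (w * swap (Fin.castLE h p) (Fin.castLE h q))) =
      alt h v (fun w => η w * φ w) -
        alt h v (fun w => η (w * swap (Fin.castLE h p) (Fin.castLE h q)) *
          φ (w * swap (Fin.castLE h p) (Fin.castLE h q))) := by
    simp only [alt, ← Finset.sum_sub_distrib, ← mul_sub]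
    refine Finset.sum_congr rfl fun σ _ => ?_
    congr 1
    generalize v * permExt h σ = w
    have hne : y (w (Fin.castLE h p)) - y (w (Fin.castLE h q)) ≠ 0 :=
      sub_ne_zero.2 fun he => hpq (Fin.castLE_injective h (w.injective (hy he)))
    simp only [hg, permDivDiff_mul_swap, hη, Perm.mul_apply, swap_apply_left]
    rw [permDivDiff]
    field_simp
  rw [h1, h2] at h3
  have h4 : (2 : K) * alt h v g = 2 * alt h v (fun w => η w * φ w) := by linear_combination h3
  exact mul_left_cancel₀ two_ne_zero h4

theorem castLE_swap {k n : ℕ} (h : k ≤ n) (p q i : Fin k) :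
    Fin.castLE h (swap p q i) = swap (Fin.castLE h p) (Fin.castLE h q) (Fin.castLE h i) :=
  ((Fin.castLE_injective h).map_swap p q i)

/-- Each step replaces `𝔖_u` by `∂ 𝔖_{us}` at an ascent `p < k` and absorbs the divided difference
with one factor `x_p`; the code at `p` rises by one as the exponent falls by one. The process stops
when the first `k` values decrease and every exponent is zero. -/
theorem exists_strictAnti_alt_eq {k n : ℕ} {K : Type*} [Field K] [CharZero K] [Algebra ℚ K]
    (h : k ≤ n) {y : Fin n → K} (hy : Function.Injective y) (v u : Perm (Fin n))
    (hu : Antitone (code fun i : Fin k => (u (Fin.castLE h i) : ℕ))) :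
    ∃ τ : Perm (Fin k), StrictAnti (fun i => ((u * permExt h τ) (Fin.castLE h i) : ℕ)) ∧
      alt h v (fun w => (∏ i : Fin k, y (w (Fin.castLE h i)) ^
        (k - 1 - i - code (fun i : Fin k => (u (Fin.castLE h i) : ℕ)) i)) * schubertValue y u w) =
        alt h v (schubertValue y (u * permExt h τ)) := by
  induction hN : ∑ a : Fin n, (a : ℕ) * (u a : ℕ) using Nat.strong_induction_on
    generalizing u with
  | _ N ih =>
  subst hN
  have hinj : Function.Injective fun i : Fin k => (u (Fin.castLE h i) : ℕ) :=
    fun a b he => Fin.castLE_injective h (u.injective (Fin.ext he))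
  rcases strictAnti_or_exists_first_ascent hinj with hanti | ⟨p, q, hpq, hlt, hfirst⟩
  · refine ⟨1, by simpa using hanti, ?_⟩
    simp [code_of_strictAnti hanti]
  · have hne : p ≠ q := fun he => by rw [he] at hpq; omega
    have hc := code_eq_of_antitone hu hpq hlt
    have hcode := code_comp_swap _ hpq hlt hc
    have hu' := antitone_code_comp_swap hu hpq hlt hfirst
    have hfun : (fun i : Fin k => (u (Fin.castLE h i) : ℕ)) ∘ swap p q =
        fun i : Fin k =>
          ((u * swap (Fin.castLE h p) (Fin.castLE h q)) (Fin.castLE h i) : ℕ) := by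
      funext i
      simp [castLE_swap]
    rw [hfun] at hu' hcode
    obtain ⟨τ, hτ, heq⟩ := ih _ (sum_mul_swap_lt' u (p := Fin.castLE h p) (q := Fin.castLE h q)
      hpq hlt) _ hu' rfl
    rw [← permExt_swap, mul_assoc, ← map_mul] at hτ heq
    refine ⟨swap p q * τ, hτ, ?_⟩
    rw [← heq, permExt_swap, hcode, schubertValue_eq_permDivDiff hy u (p := Fin.castLE h p)
      (q := Fin.castLE h q) hpq hlt]
    set c := code fun i : Fin k => (u (Fin.castLE h i) : ℕ)
    -- Since `c p = c q ≤ k - 1 - q = k - 2 - p`, the exponent at `p` is positive and a factor `x_p`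
    -- can be split off.
    have hcq := code_le (fun i : Fin k => (u (Fin.castLE h i) : ℕ)) q
    change c q ≤ _ at hcq
    refine Eq.trans ?_ (alt_mul_permDivDiff h hy v _ (fun w => ∏ i : Fin k,
      y (w (Fin.castLE h i)) ^ (k - 1 - (i : ℕ) - Function.update c p (c p + 1) i)) hne ?_)
    · congr 1
      funext w
      congr 1
      rw [← Finset.mul_prod_erase _ _ (Finset.mem_univ p),
        ← Finset.mul_prod_erase (a := p) (s := Finset.univ) (f := fun i => y (w (Fin.castLE h i)) ^
          (k - 1 - (i : ℕ) - Function.update c p (c p + 1) i)) (Finset.mem_univ p),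
        Function.update_self, ← mul_assoc, ← pow_succ']
      congr 1
      · congr 1
        have := q.2
        omega
      · refine Finset.prod_congr rfl fun i hi => ?_
        rw [Function.update_of_ne (Finset.ne_of_mem_erase hi)]
    · intro w
      simp only [Perm.mul_apply, ← castLE_swap]
      -- The remaining monomial is symmetric in `p`, `q`: the exponents agree because `q = p + 1`
      -- and `c p = c q`.
      refine prod_comp_swap_eq (fun x m => x ^ m) (fun i => y (w (Fin.castLE h i))) _ ?_
      rw [Function.update_self, Function.update_of_ne hne.symm]
      omega

theorem apply_mul_permExt {k n : ℕ} {K : Type*} (h : k ≤ n) (φ : Perm (Fin n) → K)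
    (hφ : ∀ p q : Fin k, (p : ℕ) + 1 = q →
      ∀ v, φ (v * swap (Fin.castLE h p) (Fin.castLE h q)) = φ v)
    (σ : Perm (Fin k)) : ∀ v, φ (v * permExt h σ) = φ v := by
  cases k with
  | zero => intro v; rw [Subsingleton.elim σ 1]; simp
  | succ k =>
    have hσ : σ ∈ Submonoid.closure (Set.range fun i : Fin k => swap i.castSucc i.succ) := by
      rw [Perm.mclosure_swap_castSucc_succ]; trivial
    induction hσ using Submonoid.closure_induction with
    | mem x hx =>
      obtain ⟨i, rfl⟩ := hx
      intro v
      rw [permExt_swap]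
      exact hφ _ _ (by simp) v
    | one => simp
    | mul a b _ _ ha hb => intro v; rw [map_mul, ← mul_assoc, hb, ha]

/-! ### Grassmannian permutations and the determinantal formula -/

/-- The beta numbers (first-column hook lengths, padded to `k` rows) of a partition. -/
def betaNumber (k : ℕ) (μ : YoungDiagram) (i : Fin k) : ℕ := μ.rowLen i + (k - 1 - i)

theorem grassmannianPerm_castLE {k n : ℕ} (h : k ≤ n) (μ : BoxPartition k n) (i : Fin k) :
    (grassmannianPerm μ (Fin.castLE h i) : ℕ) = i + μ.1.rowLen (k - 1 - i) := by
  simp [grassmannianPerm, grassmannianFun]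

theorem grassmannianPerm_of_le {k n : ℕ} (μ : BoxPartition k n) {i : Fin n} (hi : k ≤ i) :
    (grassmannianPerm μ i : ℕ) = i - μ.1.colLen (i - k) := by
  simp [grassmannianPerm, grassmannianFun, not_lt.2 hi]

theorem strictMono_grassmannianPerm {k n : ℕ} (h : k ≤ n) (μ : BoxPartition k n) :
    StrictMono fun i : Fin k => (grassmannianPerm μ (Fin.castLE h i) : ℕ) := by
  intro a b hab
  have h1 : (a : ℕ) < b := hab
  have := μ.1.rowLen_anti (k - 1 - b) (k - 1 - a) (by omega)
  simp only [grassmannianPerm_castLE]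
  omega

theorem grassmannianPerm_lt_of_le {k n : ℕ} (μ : BoxPartition k n) {i j : Fin n}
    (hi : k ≤ i) (hij : i < j) : grassmannianPerm μ i < grassmannianPerm μ j := by
  have h1 : (i : ℕ) < j := hij
  have h2 := μ.1.colLen_anti (i - k) (j - k) (by omega)
  have h3 : μ.1.colLen (i - k) ≤ k := by
    by_contra hcon
    have hmem : (k, i - k) ∈ μ.1 := YoungDiagram.mem_iff_lt_colLen.2 (by omega)
    have := (μ.2 _ hmem).1
    simp only at this
    omega
  rw [Fin.lt_def, grassmannianPerm_of_le μ hi, grassmannianPerm_of_le μ (by omega)]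
  omega

/-- Both sequences list the same first `k` values of the Grassmannian permutation in decreasing
order. -/
theorem eq_betaNumber_of_strictAnti {k n : ℕ} (h : k ≤ n) (μ : BoxPartition k n)
    (τ : Perm (Fin k))
    (hτ : StrictAnti fun i => ((grassmannianPerm μ * permExt h τ) (Fin.castLE h i) : ℕ))
    (i : Fin k) :
    ((grassmannianPerm μ * permExt h τ) (Fin.castLE h i) : ℕ) = betaNumber k μ.1 i := by
  set g := fun i : Fin k => (grassmannianPerm μ (Fin.castLE h i) : ℕ) with hg
  have h1 : (fun i => ((grassmannianPerm μ * permExt h τ) (Fin.castLE h i) : ℕ)) = g ∘ τ := by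
    funext i
    simp [hg, permExt_castLE]
  have h2 : betaNumber k μ.1 = g ∘ Fin.revPerm := by
    funext i
    have := i.2
    have e : k - 1 - (k - (i + 1) : ℕ) = i := by omega
    simp only [hg, Function.comp, grassmannianPerm_castLE, Fin.revPerm_apply, Fin.val_rev, e,
      betaNumber]
    omega
  have h3 : StrictAnti (g ∘ Fin.revPerm) := fun a b hab =>
    strictMono_grassmannianPerm h μ (Fin.rev_lt_rev.2 hab)
  rw [h1] at hτ
  have h4 : g ∘ τ = g ∘ Fin.revPerm := (StrictAnti.range_inj hτ h3).1 (by
    rw [Set.range_comp, Set.range_comp, τ.surjective.range_eq, Equiv.range_eq_univ])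
  rw [h2, ← h4, ← h1]

/-- Reordering the first `k` values decreasingly makes the permutation dominant. Every smaller value
then stands further right, so the code is the value itself in the first `k` positions, and zero
afterwards. -/
theorem schubertValue_of_strictAnti {k n : ℕ} {K : Type*} [Field K] [Algebra ℚ K]
    (h : k ≤ n) {y : ℕ → K} (hy : Function.Injective fun i : Fin n => y i) (μ : BoxPartition k n)
    (τ : Perm (Fin k))
    (hτ : StrictAnti fun i => ((grassmannianPerm μ * permExt h τ) (Fin.castLE h i) : ℕ))
    (v : Perm (Fin n)) :
    schubertValue (fun i : Fin n => y i) (grassmannianPerm μ * permExt h τ) v =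
      ∏ i : Fin k, newton y (y (v (Fin.castLE h i))) (betaNumber k μ.1 i) := by
  have hbeta := eq_betaNumber_of_strictAnti h μ τ hτ
  set u := grassmannianPerm μ * permExt h τ
  have hc1 : ∀ i : Fin k, code (fun i => (u i : ℕ)) (Fin.castLE h i) = u (Fin.castLE h i) := by
    intro i
    refine Eq.trans ?_ (Fin.card_Iio (u (Fin.castLE h i)))
    refine Finset.card_equiv u fun j => ?_
    simp only [Finset.mem_filter, Finset.mem_univ, true_and, Finset.mem_Iio, Fin.val_fin_lt,
      and_iff_right_iff_imp]
    intro hj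
    by_contra hcon
    have hji : (j : ℕ) ≤ i := not_lt.1 hcon
    have := hτ.antitone (show (⟨j, by omega⟩ : Fin k) ≤ i from hji)
    exact (Fin.lt_def.1 hj).not_ge this
  have hc2 : ∀ i : Fin n, k ≤ i → code (fun i => (u i : ℕ)) i = 0 := by
    intro i hi
    rw [code, Finset.card_eq_zero, Finset.filter_eq_empty_iff]
    rintro j - ⟨hij, hlt⟩
    have hj : k ≤ (j : ℕ) := hi.trans (le_of_lt hij)
    have := grassmannianPerm_lt_of_le μ hi hij
    simp only [u, Perm.mul_apply, permExt_of_le h τ hi, permExt_of_le h τ hj] at hlt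
    exact this.not_gt hlt
  have hanti : Antitone (code fun i => (u i : ℕ)) := by
    intro a b hab
    by_cases hb : (b : ℕ) < k
    · have ha : (a : ℕ) < k := lt_of_le_of_lt hab hb
      have e1 := hc1 ⟨a, ha⟩
      have e2 := hc1 ⟨b, hb⟩
      have := hτ.antitone (show (⟨a, ha⟩ : Fin k) ≤ ⟨b, hb⟩ from hab)
      simp only [Fin.castLE_mk, Fin.eta] at e1 e2 this
      omega
    · rw [hc2 b (not_lt.1 hb)]
      exact Nat.zero_le _
  rw [schubertValue_of_antitone_code hy u hanti v]
  symm
  refine Fintype.prod_of_injective (Fin.castLE h) (Fin.castLE_injective h) _ _ ?_ ?_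
  · intro i hi
    rw [hc2 i, newton_zero]
    by_contra hcon
    exact hi ⟨⟨i, not_le.1 hcon⟩, rfl⟩
  · intro i
    rw [hc1, hbeta]

/-- The values of the double Schubert polynomials of Grassmannian permutations, up to a common
factor, as determinants. -/
theorem exists_schubertValue_mul_eq_det {k n : ℕ} {K : Type*} [Field K] [CharZero K] [Algebra ℚ K]
    (h : k ≤ n) {y : ℕ → K} (hy : Function.Injective fun i : Fin n => y i)
    (ν : BoxPartition k n) :
    ∃ V : K, ∀ μ : BoxPartition k n,
      schubertValue (fun i : Fin n => y i) (grassmannianPerm μ) (grassmannianPerm ν) * V =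
        (Matrix.of fun a i : Fin k =>
          newton y (y (betaNumber k ν.1 a)) (betaNumber k μ.1 i)).det := by
  have hanti : ∀ μ : BoxPartition k n,
      Antitone (code fun i : Fin k => (grassmannianPerm μ (Fin.castLE h i) : ℕ)) := by
    intro μ a b _
    rw [code_of_strictMono (strictMono_grassmannianPerm h μ),
      code_of_strictMono (strictMono_grassmannianPerm h μ)]
  obtain ⟨τ, hτ, -⟩ := exists_strictAnti_alt_eq h hy 1 _ (hanti ν)
  set v := grassmannianPerm ν * permExt h τ
  -- The common factor is a Vandermonde determinant. The first `k` values increase for every `μ`, so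
  -- their code is zero and the monomial is the same for all `μ`.
  refine ⟨alt h v fun w => ∏ i : Fin k, y (w (Fin.castLE h i)) ^ (k - 1 - (i : ℕ)), fun μ => ?_⟩
  obtain ⟨ρ, hρ, heq⟩ := exists_strictAnti_alt_eq h hy v _ (hanti μ)
  -- The Schubert value is symmetric in the first `k` variables, so it leaves the alternating sum.
  have hsymm := apply_mul_permExt h (schubertValue (fun i : Fin n => y i) (grassmannianPerm μ))
    fun p q hpq w => schubertValue_mul_swap hy _ (p := Fin.castLE h p) (q := Fin.castLE h q) hpq
      (strictMono_grassmannianPerm h μ (Fin.lt_def.2 (by omega))) w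
  calc _ = _ := ?_
    _ = _ := heq
    _ = _ := ?_
  · rw [alt, alt, Finset.mul_sum]
    refine Finset.sum_congr rfl fun σ _ => ?_
    rw [hsymm, hsymm]
    simp only [code_of_strictMono (strictMono_grassmannianPerm h μ), Nat.sub_zero]
    ring
  · rw [alt, Matrix.det_apply']
    refine Finset.sum_congr rfl fun σ _ => ?_
    rw [schubertValue_of_strictAnti h hy μ ρ hρ]
    congr 1
    refine Finset.prod_congr rfl fun i _ => ?_
    rw [Perm.mul_apply, permExt_castLE, eq_betaNumber_of_strictAnti h ν τ hτ, Matrix.of_apply]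

/-! ### `q`-binomials and products with factorial powers -/

/-- The `q`-binomial coefficients. -/
def qBinom {K : Type*} [CommRing K] (z : K) : ℕ → ℕ → K
  | _, 0 => 1
  | 0, _ + 1 => 0
  | n + 1, s + 1 => qBinom z n s + z ^ (s + 1) * qBinom z n (s + 1)

theorem qBinom_zero_right {K : Type*} [CommRing K] (z : K) (n : ℕ) : qBinom z n 0 = 1 := by
  cases n <;> rfl

theorem qBinom_succ_succ {K : Type*} [CommRing K] (z : K) (n s : ℕ) :
    qBinom z (n + 1) (s + 1) = qBinom z n s + z ^ (s + 1) * qBinom z n (s + 1) := rfl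

theorem qBinom_of_lt {K : Type*} [CommRing K] (z : K) :
    ∀ {n s : ℕ}, n < s → qBinom z n s = 0
  | _, 0, h => absurd h (Nat.not_lt_zero _)
  | 0, _ + 1, _ => rfl
  | n + 1, s + 1, h => by
    rw [qBinom_succ_succ, qBinom_of_lt z (by omega), qBinom_of_lt z (by omega), mul_zero, add_zero]

theorem qBinom_self {K : Type*} [CommRing K] (z : K) (n : ℕ) : qBinom z n n = 1 := by
  induction n with
  | zero => rfl
  | succ n ih => rw [qBinom_succ_succ, ih, qBinom_of_lt z (Nat.lt_succ_self n), mul_zero, add_zero]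

/-- This exposes the factor `z^r - 1` of `[r choose s]_z` for `0 < s < r`, at the cost of `z^s - 1`,
which is nonzero at a primitive `r`-th root of unity. -/
theorem qBinom_succ_succ_mul {K : Type*} [CommRing K] (z : K) (n s : ℕ) :
    qBinom z (n + 1) (s + 1) * (z ^ (s + 1) - 1) = (z ^ (n + 1) - 1) * qBinom z n s := by
  induction n generalizing s with
  | zero =>
    cases s with
    | zero => simp [qBinom]
    | succ s => simp [qBinom]
  | succ n ih =>
    cases s with
    | zero =>
      have h := ih 0
      rw [qBinom_succ_succ z (n + 1), qBinom_zero_right]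
      rw [qBinom_zero_right] at h
      linear_combination z * h
    | succ s =>
      have h1 := ih (s + 1)
      have h2 := ih s
      rw [qBinom_succ_succ z (n + 1)]
      have h3 := qBinom_succ_succ z n s
      linear_combination z ^ (s + 2) * h1 + z * h2 - z * (z ^ (n + 1) - 1) * h3

/-- The expansion of `x ^ r (x | y)^m` in factorial powers, for `y_j = z^j`. -/
theorem pow_mul_newton {K : Type*} [CommRing K] (z x : K) (r m : ℕ) :
    x ^ r * newton (fun j => z ^ (j + 1)) x m = ∑ s ∈ Finset.range (r + 1),
      z ^ ((m + 1) * (r - s)) * qBinom z r s * newton (fun j => z ^ (j + 1)) x (m + s) := by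
  induction r with
  | zero => simp [qBinom]
  | succ r ih =>
    set N := newton (fun j => z ^ (j + 1)) x with hN
    -- Multiplication by `x` either lengthens the factorial power or contributes the scalar `y_M`;
    -- the two sums of `h1` are these two cases.
    have hx : ∀ M, x * N M = N (M + 1) + z ^ (M + 1) * N M := fun M => by
      rw [hN, newton_succ]; ring
    have h1 : x ^ (r + 1) * N m =
        ∑ s ∈ Finset.range (r + 1), z ^ ((m + 1) * (r - s)) * qBinom z r s * N (m + s + 1) +
        ∑ s ∈ Finset.range (r + 1),
          z ^ ((m + 1) * (r - s) + (m + s + 1)) * qBinom z r s * N (m + s) := by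
      rw [pow_succ', mul_assoc, ih, Finset.mul_sum, ← Finset.sum_add_distrib]
      refine Finset.sum_congr rfl fun s _ => ?_
      rw [pow_add]
      linear_combination z ^ ((m + 1) * (r - s)) * qBinom z r s * hx (m + s)
    have h2 : ∑ s ∈ Finset.range (r + 1),
          z ^ ((m + 1) * (r - s) + (m + s + 1)) * qBinom z r s * N (m + s) =
        ∑ s ∈ Finset.range (r + 1),
          z ^ ((m + 1) * (r - s)) * (z ^ (s + 1) * qBinom z r (s + 1)) * N (m + s + 1) +
        z ^ ((m + 1) * (r + 1)) * N m := by
      have h3 := Finset.sum_range_succ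
        (fun s => z ^ ((m + 1) * (r - s) + (m + s + 1)) * qBinom z r s * N (m + s)) (r + 1)
      rw [qBinom_of_lt z (Nat.lt_succ_self r), mul_zero, zero_mul, add_zero] at h3
      rw [← h3, Finset.sum_range_succ']
      congr 1
      · refine Finset.sum_congr rfl fun s hs => ?_
        by_cases hsr : s = r
        · subst hsr
          rw [qBinom_of_lt z (Nat.lt_succ_self s)]
          simp
        · have hs' := Finset.mem_range.1 hs
          obtain ⟨t, rfl⟩ : ∃ t, r = s + 1 + t := ⟨r - (s + 1), by omega⟩
          have e1 : s + 1 + t - (s + 1) = t := by omega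
          have e2 : s + 1 + t - s = t + 1 := by omega
          rw [e1, e2, ← add_assoc m s 1]
          ring
      · rw [qBinom_zero_right]
        simp only [Nat.sub_zero, add_zero, mul_one]
        ring
    rw [h1, h2, ← add_assoc, ← Finset.sum_add_distrib, Finset.sum_range_succ' _ (r + 1)]
    congr 1
    · refine Finset.sum_congr rfl fun s _ => ?_
      rw [qBinom_succ_succ, Nat.add_sub_add_right, ← add_assoc m s 1]
      ring
    · simp [qBinom_zero_right]

/-! ### Alternants: power sum rule and vanishing -/

/-- The numerator of a factorial Schur function at the point `(y (B a))_a`. -/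
def alternant {K : Type*} [CommRing K] {k : ℕ} (y : ℕ → K) (B μ : Fin k → ℕ) : K :=
  (Matrix.of fun a i : Fin k => newton y (y (B a)) (μ i)).det

/-- In each term of the determinant the power sum can be summed along `σ`, so that `x^r` multiplies
the factorial power in the same variable and can be expanded there. -/
theorem sum_pow_mul_alternant {K : Type*} [CommRing K] {k : ℕ} (z : K) (B μ : Fin k → ℕ) (r : ℕ) :
    (∑ j, (z ^ (B j + 1)) ^ r) * alternant (fun j => z ^ (j + 1)) B μ =
      ∑ j, ∑ s ∈ Finset.range (r + 1), z ^ ((μ j + 1) * (r - s)) * qBinom z r s *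
        alternant (fun j => z ^ (j + 1)) B (Function.update μ j (μ j + s)) := by
  set y : ℕ → K := fun j => z ^ (j + 1) with hy
  have key : ∀ σ : Perm (Fin k), (∑ j, (z ^ (B j + 1)) ^ r) * ∏ i, newton y (y (B (σ i))) (μ i) =
      ∑ j, ∑ s ∈ Finset.range (r + 1), z ^ ((μ j + 1) * (r - s)) * qBinom z r s *
        ∏ i, newton y (y (B (σ i))) (Function.update μ j (μ j + s) i) := by
    intro σ
    rw [← Equiv.sum_comp σ, Finset.sum_mul]
    refine Finset.sum_congr rfl fun j _ => ?_
    rw [← Finset.mul_prod_erase _ _ (Finset.mem_univ j), ← mul_assoc, pow_mul_newton,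
      Finset.sum_mul]
    refine Finset.sum_congr rfl fun s _ => ?_
    rw [← Finset.mul_prod_erase (a := j) (s := Finset.univ) (f := fun i =>
      newton y (y (B (σ i))) (Function.update μ j (μ j + s) i)) (Finset.mem_univ j),
      Function.update_self, mul_assoc, mul_assoc, mul_assoc]
    congr 3
    refine Finset.prod_congr rfl fun i hi => ?_
    rw [Function.update_of_ne (Finset.ne_of_mem_erase hi)]
  simp only [alternant, Matrix.det_apply', Matrix.of_apply]
  calc _ = ∑ σ : Perm (Fin k), ∑ j, ∑ s ∈ Finset.range (r + 1),
        z ^ ((μ j + 1) * (r - s)) * qBinom z r s * (((Perm.sign σ : ℤ) : K) *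
          ∏ i, newton y (y (B (σ i))) (Function.update μ j (μ j + s) i)) := by
        rw [Finset.mul_sum]
        refine Finset.sum_congr rfl fun σ _ => ?_
        rw [mul_left_comm, key σ, Finset.mul_sum]
        refine Finset.sum_congr rfl fun j _ => ?_
        rw [Finset.mul_sum]
        refine Finset.sum_congr rfl fun s _ => ?_
        ring
    _ = _ := by
        rw [Finset.sum_comm]
        refine Finset.sum_congr rfl fun j _ => ?_
        rw [Finset.sum_comm]
        refine Finset.sum_congr rfl fun s _ => ?_
        rw [Finset.mul_sum]

theorem newton_eq_zero {K : Type*} [CommRing K] (y : ℕ → K) {b m : ℕ} (h : b < m) :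
    newton y (y b) m = 0 :=
  Finset.prod_eq_zero (Finset.mem_range.2 h) (sub_self _)

/-- Every term of the determinant has some `B (σ i) < μ i`, and then the factorial power contains
the factor `y_b - y_b`. -/
theorem alternant_eq_zero {K : Type*} [CommRing K] {k : ℕ} (y : ℕ → K) {B μ : Fin k → ℕ}
    (h : ∑ i, B i < ∑ i, μ i) : alternant y B μ = 0 := by
  rw [alternant, Matrix.det_apply']
  refine Finset.sum_eq_zero fun σ _ => ?_
  rw [← Equiv.sum_comp σ B] at h
  obtain ⟨i, -, hi⟩ := Finset.exists_lt_of_sum_lt h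
  rw [Finset.prod_eq_zero (Finset.mem_univ i) (newton_eq_zero y hi), mul_zero]

/-- The signed number of sequences of `d` additions of `r` to entries of `μ` that lead to a
rearrangement of `B`. -/
def signedPathCount {k : ℕ} (r : ℕ) (B : Fin k → ℕ) : ℕ → (Fin k → ℕ) → ℤ
  | 0, μ => ∑ σ : Perm (Fin k), if μ = B ∘ σ then (Perm.sign σ : ℤ) else 0
  | d + 1, μ => ∑ j, signedPathCount r B d (Function.update μ j (μ j + r))

/-- The term of `σ` survives only if `μ i ≤ B (σ i)` for all `i`; equal sums turn this into `μ = B ∘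
σ`. -/
theorem alternant_of_sum_eq {K : Type*} [CommRing K] {k : ℕ} (y : ℕ → K) {B μ : Fin k → ℕ}
    (r : ℕ) (h : ∑ i, μ i = ∑ i, B i) :
    alternant y B μ = (signedPathCount r B 0 μ : K) * ∏ i, newton y (y (B i)) (B i) := by
  rw [alternant, Matrix.det_apply', signedPathCount, Int.cast_sum, Finset.sum_mul]
  refine Finset.sum_congr rfl fun σ _ => ?_
  simp only [Matrix.of_apply]
  by_cases hσ : μ = B ∘ σ
  · rw [if_pos hσ, hσ]
    congr 1
    exact Equiv.prod_comp σ fun i => newton y (y (B i)) (B i)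
  · rw [if_neg hσ, Int.cast_zero, zero_mul]
    have hex : ∃ i, B (σ i) < μ i := by
      by_contra hcon
      push Not at hcon
      rw [← Equiv.sum_comp σ B] at h
      exact hσ (funext fun i => (Finset.sum_eq_sum_iff_of_le fun i _ => hcon i).1 h i
        (Finset.mem_univ i))
    obtain ⟨i, hi⟩ := hex
    rw [Finset.prod_eq_zero (Finset.mem_univ i) (newton_eq_zero y hi), mul_zero]

/-! ### Values of rational functions at a root of unity -/

/-- The rational function `g` is defined at `ζ`, with value `c`. -/
def HasVal (ζ : ℂ) (g : RatFunc ℚ) (c : ℂ) : Prop :=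
  ∃ p q : Polynomial ℚ, Polynomial.aeval ζ q ≠ 0 ∧
    g * algebraMap (Polynomial ℚ) (RatFunc ℚ) q = algebraMap (Polynomial ℚ) (RatFunc ℚ) p ∧
    Polynomial.aeval ζ p = c * Polynomial.aeval ζ q

theorem hasVal_algebraMap (ζ : ℂ) (p : Polynomial ℚ) :
    HasVal ζ (algebraMap (Polynomial ℚ) (RatFunc ℚ) p) (Polynomial.aeval ζ p) :=
  ⟨p, 1, by simp, by simp, by simp⟩

theorem hasVal_X (ζ : ℂ) : HasVal ζ RatFunc.X ζ := by
  have := hasVal_algebraMap ζ Polynomial.X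
  rwa [RatFunc.algebraMap_X, Polynomial.aeval_X] at this

theorem hasVal_intCast (ζ : ℂ) (a : ℤ) : HasVal ζ (a : RatFunc ℚ) a := by
  have := hasVal_algebraMap ζ (a : Polynomial ℚ)
  rwa [map_intCast, map_intCast] at this

theorem hasVal_zero (ζ : ℂ) : HasVal ζ 0 0 := by simpa using hasVal_intCast ζ 0

theorem hasVal_one (ζ : ℂ) : HasVal ζ 1 1 := by simpa using hasVal_intCast ζ 1

theorem HasVal.add {ζ : ℂ} {f g : RatFunc ℚ} {a b : ℂ} (hf : HasVal ζ f a) (hg : HasVal ζ g b) :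
    HasVal ζ (f + g) (a + b) := by
  obtain ⟨p, q, h1, h2, h3⟩ := hf
  obtain ⟨p', q', h1', h2', h3'⟩ := hg
  refine ⟨p * q' + p' * q, q * q', by simp [h1, h1'], ?_, ?_⟩
  · simp only [map_mul, map_add, ← h2, ← h2']; ring
  · simp only [map_mul, map_add, h3, h3']; ring

theorem HasVal.mul {ζ : ℂ} {f g : RatFunc ℚ} {a b : ℂ} (hf : HasVal ζ f a) (hg : HasVal ζ g b) :
    HasVal ζ (f * g) (a * b) := by
  obtain ⟨p, q, h1, h2, h3⟩ := hf
  obtain ⟨p', q', h1', h2', h3'⟩ := hg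
  refine ⟨p * p', q * q', by simp [h1, h1'], ?_, ?_⟩
  · simp only [map_mul, ← h2, ← h2']; ring
  · simp only [map_mul, h3, h3']; ring

theorem HasVal.sub {ζ : ℂ} {f g : RatFunc ℚ} {a b : ℂ} (hf : HasVal ζ f a) (hg : HasVal ζ g b) :
    HasVal ζ (f - g) (a - b) := by
  simpa [sub_eq_add_neg] using hf.add ((hasVal_intCast ζ (-1)).mul hg)

theorem HasVal.pow {ζ : ℂ} {f : RatFunc ℚ} {a : ℂ} (hf : HasVal ζ f a) (n : ℕ) :
    HasVal ζ (f ^ n) (a ^ n) := by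
  induction n with
  | zero => simpa using hasVal_one ζ
  | succ n ih => rw [pow_succ, pow_succ]; exact ih.mul hf

theorem HasVal.inv {ζ : ℂ} {f : RatFunc ℚ} {a : ℂ} (hf : HasVal ζ f a) (ha : a ≠ 0) :
    HasVal ζ f⁻¹ a⁻¹ := by
  obtain ⟨p, q, h1, h2, h3⟩ := hf
  have hp : Polynomial.aeval ζ p ≠ 0 := by rw [h3]; exact mul_ne_zero ha h1
  have hp' : algebraMap (Polynomial ℚ) (RatFunc ℚ) p ≠ 0 := by
    intro h
    rw [(map_eq_zero_iff _ (RatFunc.algebraMap_injective ℚ)).1 h] at hp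
    simp at hp
  have hf0 : f ≠ 0 := by
    rintro rfl
    rw [zero_mul] at h2
    exact hp' h2.symm
  refine ⟨q, p, hp, ?_, ?_⟩
  · rw [← h2, inv_mul_cancel_left₀ hf0]
  · rw [h3, inv_mul_cancel_left₀ ha]

theorem HasVal.sum {ζ : ℂ} {ι : Type*} {s : Finset ι} {f : ι → RatFunc ℚ} {a : ι → ℂ}
    (h : ∀ i ∈ s, HasVal ζ (f i) (a i)) : HasVal ζ (∑ i ∈ s, f i) (∑ i ∈ s, a i) := by
  classical
  induction s using Finset.induction_on with
  | empty => simpa using hasVal_zero ζ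
  | insert i s hi ih =>
    rw [Finset.sum_insert hi, Finset.sum_insert hi]
    exact (h i (Finset.mem_insert_self i s)).add
      (ih fun j hj => h j (Finset.mem_insert_of_mem hj))

theorem exists_hasVal_qBinom (ζ : ℂ) (n s : ℕ) : ∃ c, HasVal ζ (qBinom RatFunc.X n s) c := by
  induction n generalizing s with
  | zero =>
    cases s with
    | zero => exact ⟨1, hasVal_one ζ⟩
    | succ s => exact ⟨0, hasVal_zero ζ⟩
  | succ n ih =>
    cases s with
    | zero => exact ⟨1, hasVal_one ζ⟩
    | succ s =>
      obtain ⟨a, ha⟩ := ih s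
      obtain ⟨b, hb⟩ := ih (s + 1)
      exact ⟨_, ha.add (((hasVal_X ζ).pow _).mul hb)⟩

/-- A fraction with value zero forces the reduced numerator to vanish at `ζ`; coprimality then keeps
the reduced denominator nonzero there. -/
theorem isLittleO_of_hasVal {r : ℕ} {g : RatFunc ℚ}
    (h : ∀ ζ : ℂ, IsPrimitiveRoot ζ r → HasVal ζ g 0) : IsLittleO r g := by
  intro ζ hζ
  obtain ⟨p, q, hq, hpq, hp⟩ := h ζ hζ
  have hd := RatFunc.denom_ne_zero g
  have hd' : algebraMap (Polynomial ℚ) (RatFunc ℚ) g.denom ≠ 0 := by simpa using hd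
  have h1 : g.num * q = p * g.denom := by
    apply RatFunc.algebraMap_injective ℚ
    rw [map_mul, map_mul, ← hpq]
    nth_rewrite 2 [← RatFunc.num_div_denom g]
    field_simp
  have h2 := congrArg (Polynomial.aeval ζ) h1
  rw [map_mul, map_mul, hp, zero_mul, zero_mul] at h2
  have h3 : Polynomial.aeval ζ g.num = 0 := (mul_eq_zero.1 h2).resolve_right hq
  refine ⟨fun h4 => ?_, h3⟩
  obtain ⟨a, b, hab⟩ := RatFunc.isCoprime_num_denom g
  have := congrArg (Polynomial.aeval ζ) hab
  simp [h3, h4] at this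

theorem ratFunc_X_pow_injective :
    Function.Injective fun j : ℕ => (RatFunc.X : RatFunc ℚ) ^ j := by
  intro a b h
  simp only [← RatFunc.algebraMap_X, ← map_pow] at h
  have := congrArg Polynomial.natDegree (RatFunc.algebraMap_injective ℚ h)
  simpa using this

theorem X_pow_sub_one_ne_zero {r : ℕ} (hr : 1 ≤ r) : (RatFunc.X : RatFunc ℚ) ^ r - 1 ≠ 0 := by
  intro h
  have := @ratFunc_X_pow_injective r 0 (by simpa using sub_eq_zero.1 h)
  omega

theorem prod_newton_self_ne_zero {k : ℕ} (B : Fin k → ℕ) :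
    ∏ i, newton (fun j => (RatFunc.X : RatFunc ℚ) ^ (j + 1)) (RatFunc.X ^ (B i + 1)) (B i) ≠ 0 := by
  refine Finset.prod_ne_zero_iff.2 fun i _ => Finset.prod_ne_zero_iff.2 fun j hj => ?_
  refine sub_ne_zero.2 fun h => ?_
  have := ratFunc_X_pow_injective h
  have := Finset.mem_range.1 hj
  omega

theorem exists_sum_pow_sub_eq {k r : ℕ} {ζ : ℂ} (hζ : IsPrimitiveRoot ζ r)
    (B μ : Fin k → ℕ) :
    ∃ U : RatFunc ℚ, HasVal ζ U ((∑ j, (B j : ℂ)) - ∑ j, (μ j : ℂ)) ∧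
      ∑ j, ((RatFunc.X : RatFunc ℚ) ^ (B j + 1)) ^ r - ∑ j, (RatFunc.X ^ (μ j + 1)) ^ r =
        (RatFunc.X ^ r - 1) * U := by
  have hgeom : ∀ a : ℕ, HasVal ζ (∑ i ∈ Finset.range a, ((RatFunc.X : RatFunc ℚ) ^ r) ^ i) a := by
    intro a
    have h := HasVal.sum (s := Finset.range a) (f := fun i => ((RatFunc.X : RatFunc ℚ) ^ r) ^ i)
      fun i _ => ((hasVal_X ζ).pow r).pow i
    simpa [hζ.pow_eq_one] using h
  -- Here `(z^r)^a - 1` is divided by `z^r - 1`: the geometric sum has value `a` at `ζ`, and the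
  -- shifts by one cancel between `B` and `μ`.
  refine ⟨∑ j, ∑ i ∈ Finset.range (B j + 1), (RatFunc.X ^ r) ^ i -
    ∑ j, ∑ i ∈ Finset.range (μ j + 1), (RatFunc.X ^ r) ^ i, ?_, ?_⟩
  · have h := (HasVal.sum (s := Finset.univ) fun j _ => hgeom (B j + 1)).sub
      (HasVal.sum (s := Finset.univ) fun j _ => hgeom (μ j + 1))
    convert h using 1
    push_cast
    simp only [Finset.sum_add_distrib]
    ring
  · have h : ∀ a : ℕ, (RatFunc.X ^ r - 1) * ∑ i ∈ Finset.range a, ((RatFunc.X : RatFunc ℚ) ^ r) ^ i =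
        (RatFunc.X ^ a) ^ r - 1 := fun a => by
      rw [mul_geom_sum, ← pow_mul, ← pow_mul, mul_comm]
    rw [mul_sub, Finset.mul_sum, Finset.mul_sum]
    simp only [h, Finset.sum_sub_distrib]
    ring

theorem sum_update_add {k : ℕ} (μ : Fin k → ℕ) (j : Fin k) (s : ℕ) :
    ∑ i, Function.update μ j (μ j + s) i = ∑ i, μ i + s := by
  rw [← Finset.add_sum_erase _ _ (Finset.mem_univ j), ← Finset.add_sum_erase _ μ
    (Finset.mem_univ j), Function.update_self, Finset.sum_congr rfl fun i hi =>
    Function.update_of_ne (Finset.ne_of_mem_erase hi) _ _]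
  ring

/-! ### The leading coefficient of an alternant at a root of unity -/

/-- Strong induction on the deficit `m`, through the power sum rule divided by `(z^r - 1) U`. Since
`U` has value `m ≠ 0` at `ζ`, only the factor `z^r - 1` costs a power. -/
theorem exists_hasVal_alternant {k r : ℕ} (hr : 1 ≤ r) {ζ : ℂ} (hζ : IsPrimitiveRoot ζ r)
    (B : Fin k → ℕ) (m : ℕ) (μ : Fin k → ℕ) (hm : ∑ i, μ i + m = ∑ i, B i) :
    ∃ c : ℂ, HasVal ζ ((RatFunc.X ^ r - 1) ^ (m / r) *
      (alternant (fun j => RatFunc.X ^ (j + 1)) B μ /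
        ∏ i, newton (fun j => RatFunc.X ^ (j + 1)) (RatFunc.X ^ (B i + 1)) (B i))) c ∧
      ∀ d, m = r * d → c * ((r : ℂ) ^ d * (d.factorial : ℂ)) = signedPathCount r B d μ := by
  induction m using Nat.strong_induction_on generalizing μ with
  | _ m ih =>
  set D := ∏ i, newton (fun j => (RatFunc.X : RatFunc ℚ) ^ (j + 1)) (RatFunc.X ^ (B i + 1)) (B i)
    with hDdef
  have hD : D ≠ 0 := prod_newton_self_ne_zero B
  set w : RatFunc ℚ := RatFunc.X ^ r - 1 with hw
  have hw0 : w ≠ 0 := X_pow_sub_one_ne_zero hr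
  have hwval : HasVal ζ w 0 := by
    simpa [hζ.pow_eq_one] using ((hasVal_X ζ).pow r).sub (hasVal_one ζ)
  set A := alternant (fun j => (RatFunc.X : RatFunc ℚ) ^ (j + 1)) B with hA
  rcases Nat.eq_zero_or_pos m with rfl | hpos
  · refine ⟨signedPathCount r B 0 μ, ?_, ?_⟩
    · rw [hA, alternant_of_sum_eq _ r (by omega), mul_div_assoc, div_self hD, Nat.zero_div, pow_zero,
        one_mul, mul_one]
      exact hasVal_intCast ζ _
    · intro d hd
      obtain rfl : d = 0 := by
        rcases Nat.mul_eq_zero.1 hd.symm with h | h <;> omega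
      simp
  -- With `s = t + 1`: the alternant is zero if `s > m`; if `s = r`, the drop of `⌊m/r⌋` by one pays
  -- for the denominator `w`; if `s < r`, the `q`-binomial supplies that `w`.
  · have hterm : ∀ j : Fin k, ∀ t ∈ Finset.range r, ∃ c : ℂ,
        HasVal ζ (w ^ (m / r) * (RatFunc.X ^ ((μ j + 1) * (r - (t + 1))) *
          qBinom RatFunc.X r (t + 1) * A (Function.update μ j (μ j + (t + 1)))) / (w * D)) c ∧
        ∀ d, m = r * (d + 1) → c * ((r : ℂ) ^ d * (d.factorial : ℂ)) =
          if t + 1 = r then (signedPathCount r B d (Function.update μ j (μ j + r)) : ℂ) else 0 := by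
      intro j t ht
      have htr := Finset.mem_range.1 ht
      by_cases htm : m < t + 1
      · have h0 : A (Function.update μ j (μ j + (t + 1))) = 0 :=
          alternant_eq_zero _ (by rw [sum_update_add]; omega)
        refine ⟨0, ?_, ?_⟩
        · rw [h0, mul_zero, mul_zero, zero_div]
          exact hasVal_zero ζ
        · intro d hd
          have : r ≤ m := hd ▸ Nat.le_mul_of_pos_right r (Nat.succ_pos d)
          omega
      · obtain ⟨c, hc, hcd⟩ := ih (m - (t + 1)) (by omega)
          (Function.update μ j (μ j + (t + 1))) (by rw [sum_update_add]; omega)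
        by_cases htr' : t + 1 = r
        · refine ⟨c, ?_, ?_⟩
          · convert hc using 1
            have h1 : m / r = (m - (t + 1)) / r + 1 := by
              rw [htr', ← Nat.add_div_right _ (by omega)]
              congr 1
              omega
            rw [h1, htr', qBinom_self, Nat.sub_self, mul_zero, pow_zero, pow_succ]
            field_simp
          · intro d hd
            rw [if_pos htr']
            rw [hcd d (by rw [htr', hd]; exact Nat.sub_eq_of_eq_add (by ring)), htr']
        · obtain ⟨e, he⟩ := exists_hasVal_qBinom ζ (r - 1) t
          have hz : HasVal ζ ((RatFunc.X : RatFunc ℚ) ^ (t + 1) - 1) (ζ ^ (t + 1) - 1) :=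
            ((hasVal_X ζ).pow _).sub (hasVal_one ζ)
          have hz0 : ζ ^ (t + 1) - 1 ≠ 0 :=
            sub_ne_zero.2 (hζ.pow_ne_one_of_pos_of_lt (Nat.succ_ne_zero t) (by omega))
          have hz1 : (RatFunc.X : RatFunc ℚ) ^ (t + 1) - 1 ≠ 0 :=
            X_pow_sub_one_ne_zero (Nat.succ_pos t)
          have hq : qBinom (RatFunc.X : RatFunc ℚ) r (t + 1) =
              w * (qBinom RatFunc.X (r - 1) t * (RatFunc.X ^ (t + 1) - 1)⁻¹) := by
            have h := qBinom_succ_succ_mul (RatFunc.X : RatFunc ℚ) (r - 1) t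
            rw [Nat.sub_add_cancel hr] at h
            rw [← mul_assoc, ← h, mul_inv_cancel_right₀ hz1]
          -- The unused power `w ^ δ` makes the term vanish at `ζ` when `δ > 0`, which is the case
          -- when `r` divides `m`.
          obtain ⟨δ, hδ⟩ : ∃ δ, m / r = (m - (t + 1)) / r + δ :=
            ⟨_, (Nat.add_sub_cancel' (Nat.div_le_div_right (Nat.sub_le m (t + 1)))).symm⟩
          refine ⟨ζ ^ ((μ j + 1) * (r - (t + 1))) * (e * (ζ ^ (t + 1) - 1)⁻¹) * (0 ^ δ * c), ?_, ?_⟩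
          · have hval := (((hasVal_X ζ).pow ((μ j + 1) * (r - (t + 1)))).mul
              (he.mul (hz.inv hz0))).mul ((hwval.pow δ).mul hc)
            convert hval using 1
            rw [hq, hδ, pow_add]
            field_simp
          · intro d hd
            rw [if_neg htr']
            have hδ1 : δ ≠ 0 := by
              rintro rfl
              have h1 : m / r = d + 1 := by rw [hd, Nat.mul_div_cancel_left _ hr]
              have h2 : (m - (t + 1)) / r < d + 1 := by
                rw [Nat.div_lt_iff_lt_mul hr, mul_comm, ← hd]
                omega
              omega
            rw [zero_pow hδ1]
            ring
    choose! c hc hcd using hterm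
    obtain ⟨U, hU, hUeq⟩ := exists_sum_pow_sub_eq hζ B μ
    have hUm : (∑ j, (B j : ℂ)) - ∑ j, (μ j : ℂ) = m := by
      have : ((∑ i, μ i + m : ℕ) : ℂ) = (∑ i, B i : ℕ) := by rw [hm]
      push_cast at this
      rw [← this]; ring
    rw [hUm] at hU
    have hm0 : (m : ℂ) ≠ 0 := Nat.cast_ne_zero.2 (by omega)
    have hU0 : U ≠ 0 := by
      rintro rfl
      obtain ⟨p, q, h1, h2, h3⟩ := hU
      rw [zero_mul, eq_comm, map_eq_zero_iff _ (RatFunc.algebraMap_injective ℚ)] at h2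
      rw [h2, map_zero] at h3
      exact (mul_ne_zero hm0 h1) h3.symm
    -- The summand `s = 0` of the power sum rule is a multiple of `A μ` and has been moved to the
    -- left.
    have hrec : w * U * A μ = ∑ j, ∑ t ∈ Finset.range r,
        RatFunc.X ^ ((μ j + 1) * (r - (t + 1))) *
          qBinom RatFunc.X r (t + 1) * A (Function.update μ j (μ j + (t + 1))) := by
      have h := sum_pow_mul_alternant (RatFunc.X : RatFunc ℚ) B μ r
      simp only [Finset.sum_range_succ' _ r, Finset.sum_add_distrib, Nat.sub_zero,
        qBinom_zero_right, add_zero, mul_one, Function.update_eq_self, ← Finset.sum_mul] at h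
      simp only [pow_mul] at h ⊢
      rw [← hUeq, sub_mul, h, hA]
      simp
    refine ⟨(m : ℂ)⁻¹ * ∑ j, ∑ t ∈ Finset.range r, c j t, ?_, ?_⟩
    · have hval := (hU.inv hm0).mul (HasVal.sum (s := Finset.univ) fun j _ =>
        HasVal.sum (s := Finset.range r) fun t ht => hc j t ht)
      convert hval using 1
      simp only [← Finset.sum_div, ← Finset.mul_sum]
      rw [← hrec]
      field_simp
    · intro d hd
      obtain ⟨d, rfl⟩ : ∃ d', d = d' + 1 :=
        ⟨d - 1, by rcases d with _ | d <;> simp_all⟩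
      have h1 : ∀ j, (∑ t ∈ Finset.range r, c j t) * ((r : ℂ) ^ d * (d.factorial : ℂ)) =
          signedPathCount r B d (Function.update μ j (μ j + r)) := by
        intro j
        rw [Finset.sum_mul, Finset.sum_congr rfl fun t ht => hcd j t ht d hd,
          Finset.sum_eq_single (r - 1)]
        · rw [if_pos (by omega)]
        · intro t _ ht
          rw [if_neg (by omega)]
        · intro h
          exact absurd (Finset.mem_range.2 (by omega)) h
      rw [signedPathCount, Int.cast_sum, ← Finset.sum_congr rfl fun j _ => h1 j, ← Finset.sum_mul,
        Nat.factorial_succ]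
      have hmc : (m : ℂ) = r * (d + 1) := by rw [hd]; push_cast; ring
      rw [inv_mul_eq_div, div_mul_eq_mul_div, div_eq_iff hm0, hmc]
      push_cast
      ring

/-! ### Skew shapes and rim hooks through row lengths -/

theorem mem_skewCells {μ ν : YoungDiagram} {c : ℕ × ℕ} :
    c ∈ skewCells μ ν ↔ μ.rowLen c.1 ≤ c.2 ∧ c.2 < ν.rowLen c.1 := by
  obtain ⟨i, j⟩ := c
  rw [skewCells, Finset.mem_sdiff, YoungDiagram.mem_cells, YoungDiagram.mem_cells,
    YoungDiagram.mem_iff_lt_rowLen, YoungDiagram.mem_iff_lt_rowLen, not_lt, and_comm]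

theorem le_iff_rowLen_le {μ ν : YoungDiagram} : μ ≤ ν ↔ ∀ i, μ.rowLen i ≤ ν.rowLen i := by
  constructor
  · intro h i
    by_contra hcon
    have h1 : (i, ν.rowLen i) ∈ μ := YoungDiagram.mem_iff_lt_rowLen.2 (not_le.1 hcon)
    exact lt_irrefl _ (YoungDiagram.mem_iff_lt_rowLen.1 (h h1))
  · rintro h ⟨i, j⟩ hc
    exact YoungDiagram.mem_iff_lt_rowLen.2 ((YoungDiagram.mem_iff_lt_rowLen.1 hc).trans_le (h i))

theorem eq_of_rowLen_eq {μ ν : YoungDiagram} (h : ∀ i, μ.rowLen i = ν.rowLen i) : μ = ν :=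
  le_antisymm (le_iff_rowLen_le.2 fun i => (h i).le) (le_iff_rowLen_le.2 fun i => (h i).ge)

/-- The Young diagram with at most `k` rows and with given row lengths. -/
def ofRowLenFun (g : ℕ → ℕ) (hg : Antitone g) (k : ℕ) : YoungDiagram where
  cells := (Finset.range k ×ˢ Finset.range (g 0)).filter fun c => c.2 < g c.1
  isLowerSet := by
    rintro ⟨a, b⟩ ⟨a', b'⟩ hle h
    simp only [Finset.coe_filter, Finset.mem_product, Finset.mem_range, Set.mem_ofPred_eq,
      Prod.mk_le_mk] at h hle ⊢
    have h1 := hg hle.1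
    exact ⟨⟨by omega, by omega⟩, by omega⟩

theorem rowLen_ofRowLenFun {g : ℕ → ℕ} (hg : Antitone g) {k : ℕ} (hk : g k = 0) (i : ℕ) :
    (ofRowLenFun g hg k).rowLen i = g i := by
  have hmem : ∀ j, (i, j) ∈ ofRowLenFun g hg k ↔ j < g i := by
    intro j
    rw [← YoungDiagram.mem_cells]
    simp only [ofRowLenFun, Finset.mem_filter, Finset.mem_product, Finset.mem_range,
      and_iff_right_iff_imp]
    intro hj
    refine ⟨?_, hj.trans_le (hg (Nat.zero_le i))⟩
    by_contra hcon
    have := hg (not_lt.1 hcon)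
    omega
  refine le_antisymm ?_ ?_
  · by_contra hcon
    exact lt_irrefl _ ((hmem _).1 (YoungDiagram.mem_iff_lt_rowLen.2 (not_le.1 hcon)))
  · by_contra hcon
    exact lt_irrefl _ (YoungDiagram.mem_iff_lt_rowLen.1 ((hmem _).2 (not_le.1 hcon)))

theorem card_cells_eq_sum_rowLen {μ : YoungDiagram} {k : ℕ} (hk : μ.rowLen k = 0) :
    μ.cells.card = ∑ i : Fin k, μ.rowLen i := by
  rw [← Finset.sum_range fun i => μ.rowLen i,
    Finset.card_eq_sum_card_fiberwise (f := Prod.fst) (t := Finset.range k)]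
  · exact Finset.sum_congr rfl fun i _ => (μ.rowLen_eq_card).symm
  · rintro ⟨i, j⟩ h
    have h1 := YoungDiagram.mem_iff_lt_rowLen.1 ((YoungDiagram.mem_cells _).1 h)
    simp only [Finset.coe_range, Set.mem_Iio]
    by_contra hcon
    have := μ.rowLen_anti k i (not_lt.1 hcon)
    omega

theorem sum_betaNumber_add_card {μ ν : YoungDiagram} {k : ℕ} (hμ : μ.rowLen k = 0)
    (hν : ν.rowLen k = 0) (hle : μ ≤ ν) :
    ∑ i, betaNumber k μ i + (skewCells μ ν).card = ∑ i, betaNumber k ν i := by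
  have h1 : (skewCells μ ν).card + μ.cells.card = ν.cells.card :=
    Finset.card_sdiff_add_card_eq_card (YoungDiagram.cells_subset_iff.2 hle)
  rw [card_cells_eq_sum_rowLen hμ, card_cells_eq_sum_rowLen hν] at h1
  simp only [betaNumber, Finset.sum_add_distrib]
  omega

/-- Row lengths of a rim hook `ν / μ` that occupies the rows from `p` to `j`. -/
structure IsStrip (μ ν : YoungDiagram) (p j : ℕ) : Prop where
  le : p ≤ j
  above : ∀ i < p, ν.rowLen i = μ.rowLen i
  top : μ.rowLen p < ν.rowLen p
  step : ∀ i, p ≤ i → i < j → ν.rowLen (i + 1) = μ.rowLen i + 1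
  below : ∀ i, j < i → ν.rowLen i = μ.rowLen i

theorem IsStrip.lt {μ ν : YoungDiagram} {p j : ℕ} (h : IsStrip μ ν p j) {i : ℕ} (hp : p ≤ i)
    (hj : i ≤ j) : μ.rowLen i < ν.rowLen i := by
  rcases Nat.eq_or_lt_of_le hp with rfl | hlt
  · exact h.top
  · obtain ⟨i, rfl⟩ : ∃ i', i = i' + 1 := ⟨i - 1, by omega⟩
    rw [h.step i (by omega) (by omega)]
    exact Nat.lt_succ_of_le (μ.rowLen_anti i (i + 1) (Nat.le_succ i))

theorem IsStrip.mem_rows {μ ν : YoungDiagram} {p j : ℕ} (h : IsStrip μ ν p j) {c : ℕ × ℕ}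
    (hc : c ∈ skewCells μ ν) : p ≤ c.1 ∧ c.1 ≤ j := by
  have hc' := mem_skewCells.1 hc
  constructor
  · by_contra hcon
    have := h.above c.1 (not_le.1 hcon)
    omega
  · by_contra hcon
    have := h.below c.1 (not_le.1 hcon)
    omega

theorem IsStrip.subset {μ ν : YoungDiagram} {p j : ℕ} (h : IsStrip μ ν p j) : μ ≤ ν := by
  refine le_iff_rowLen_le.2 fun i => ?_
  by_cases h1 : i < p
  · exact (h.above i h1).ge
  · by_cases h2 : j < i
    · exact (h.below i h2).ge
    · exact (h.lt (not_lt.1 h1) (not_lt.1 h2)).le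

theorem IsStrip.rimHookHeight_eq {μ ν : YoungDiagram} {p j : ℕ} (h : IsStrip μ ν p j) :
    rimHookHeight μ ν = j - p := by
  have : (skewCells μ ν).image Prod.fst = Finset.Icc p j := by
    ext i
    simp only [Finset.mem_image, Finset.mem_Icc]
    constructor
    · rintro ⟨c, hc, rfl⟩
      exact h.mem_rows hc
    · rintro ⟨h1, h2⟩
      exact ⟨(i, μ.rowLen i), mem_skewCells.2 ⟨le_rfl, h.lt h1 h2⟩, rfl⟩
  rw [rimHookHeight, this, Nat.card_Icc]
  omega

/-- Each row is an interval, and consecutive rows share exactly one column: this connects the cells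
and excludes a `2 × 2` square. -/
theorem IsStrip.isRimHook {μ ν : YoungDiagram} {p j : ℕ} (h : IsStrip μ ν p j) :
    IsRimHook μ ν := by
  refine ⟨h.subset, ?_, ?_⟩
  · have hrow : ∀ i (hi : p ≤ i ∧ i ≤ j) (t : ℕ) (ht : μ.rowLen i + t < ν.rowLen i),
        (cellGraph.induce (skewCells μ ν : Set (ℕ × ℕ))).Reachable
          ⟨(i, μ.rowLen i + t), Finset.mem_coe.2 (mem_skewCells.2 ⟨Nat.le_add_right _ _, ht⟩)⟩
          ⟨(i, μ.rowLen i), Finset.mem_coe.2 (mem_skewCells.2 ⟨le_rfl, h.lt hi.1 hi.2⟩)⟩ := by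
      intro i hi t
      induction t with
      | zero => exact fun _ => SimpleGraph.Reachable.refl _
      | succ t ih =>
        intro ht
        refine (SimpleGraph.Adj.reachable ?_).trans (ih (by omega))
        exact Or.inl ⟨rfl, Or.inr rfl⟩
    have hcol : ∀ (t : ℕ) (ht : p + t ≤ j),
        (cellGraph.induce (skewCells μ ν : Set (ℕ × ℕ))).Reachable
          ⟨(p + t, μ.rowLen (p + t)), Finset.mem_coe.2 (mem_skewCells.2
            ⟨le_rfl, h.lt (Nat.le_add_right _ _) ht⟩)⟩
          ⟨(p, μ.rowLen p), Finset.mem_coe.2 (mem_skewCells.2 ⟨le_rfl, h.top⟩)⟩ := by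
      intro t
      induction t with
      | zero => exact fun _ => SimpleGraph.Reachable.refl _
      | succ t ih =>
        intro ht
        have h1 := h.step (p + t) (by omega) (by omega)
        have h2 := μ.rowLen_anti (p + t) (p + t + 1) (by omega)
        have h3 := hrow (p + t + 1) ⟨by omega, by omega⟩
          (μ.rowLen (p + t) - μ.rowLen (p + t + 1)) (by omega)
        refine h3.symm.trans (SimpleGraph.Reachable.trans (SimpleGraph.Adj.reachable ?_)
          (ih (by omega)))
        refine Or.inr ⟨?_, Or.inr rfl⟩
        change μ.rowLen (p + t + 1) + (μ.rowLen (p + t) - μ.rowLen (p + t + 1)) =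
          μ.rowLen (p + t)
        omega
    refine (SimpleGraph.connected_iff_exists_forall_reachable _).2
      ⟨⟨(p, μ.rowLen p), Finset.mem_coe.2 (mem_skewCells.2 ⟨le_rfl, h.top⟩)⟩, ?_⟩
    rintro ⟨⟨i, c⟩, hc⟩
    have hc' := mem_skewCells.1 (Finset.mem_coe.1 hc)
    have hi := h.mem_rows (Finset.mem_coe.1 hc)
    simp only at hc' hi
    obtain ⟨s, rfl⟩ := Nat.exists_eq_add_of_le hi.1
    obtain ⟨t, rfl⟩ := Nat.exists_eq_add_of_le hc'.1
    exact ((hrow (p + s) hi t hc'.2).trans (hcol s hi.2)).symm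
  · rintro i c ⟨h1, -, -, h2⟩
    have e1 := h.mem_rows h1
    have e2 := h.mem_rows h2
    have e3 := mem_skewCells.1 h1
    have e4 := mem_skewCells.1 h2
    simp only at e1 e2 e3 e4
    have := h.step i e1.1 (by omega)
    omega

/-- Connectedness makes adjacent rows overlap in at least one column, and the absence of a `2 × 2`
square in at most one. -/
theorem IsRimHook.exists_isStrip {μ ν : YoungDiagram} (h : IsRimHook μ ν) :
    ∃ p j, IsStrip μ ν p j := by
  obtain ⟨hle, hconn, hsq⟩ := h
  have hle' := le_iff_rowLen_le.1 hle
  have hne : ((skewCells μ ν).image Prod.fst).Nonempty := by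
    obtain ⟨c⟩ := hconn.nonempty
    exact ⟨_, Finset.mem_image_of_mem _ (Finset.mem_coe.1 c.2)⟩
  set I := (skewCells μ ν).image Prod.fst with hI
  have hmem : ∀ i, μ.rowLen i < ν.rowLen i → i ∈ I := fun i hi =>
    Finset.mem_image.2 ⟨(i, μ.rowLen i), mem_skewCells.2 ⟨le_rfl, hi⟩, rfl⟩
  have hmem' : ∀ i ∈ I, μ.rowLen i < ν.rowLen i := by
    intro i hi
    obtain ⟨c, hc, rfl⟩ := Finset.mem_image.1 hi
    have := mem_skewCells.1 hc
    omega
  have hout : ∀ i, i ∉ I → ν.rowLen i = μ.rowLen i := fun i hi =>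
    le_antisymm (not_lt.1 fun hlt => hi (hmem i hlt)) (hle' i)
  refine ⟨I.min' hne, I.max' hne, I.min'_le _ (I.max'_mem hne),
    fun i hi => hout i fun hiI => hi.not_ge (I.min'_le i hiI), hmem' _ (I.min'_mem hne), ?_,
    fun i hi => hout i fun hiI => hi.not_ge (I.le_max' i hiI)⟩
  intro i hpi hij
  obtain ⟨a, ha, ha'⟩ := Finset.mem_image.1 (I.min'_mem hne)
  obtain ⟨b, hb, hb'⟩ := Finset.mem_image.1 (I.max'_mem hne)
  obtain ⟨w⟩ := hconn.preconnected ⟨a, Finset.mem_coe.2 ha⟩ ⟨b, Finset.mem_coe.2 hb⟩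
  -- A path from the top row to the bottom row must step from row `i` to row `i + 1`, within a
  -- single column.
  obtain ⟨dt, -, hd1, hd2⟩ := w.exists_boundary_dart {c | c.1.1 ≤ i} (by simp [ha', hpi])
    (fun hcon => by have hcon' : b.1 ≤ i := hcon; omega)
  obtain ⟨⟨⟨⟨i1, c1⟩, hc1⟩, ⟨⟨i2, c2⟩, hc2⟩⟩, hadj⟩ := dt
  have hadj' : (i1 = i2 ∧ (c1 + 1 = c2 ∨ c2 + 1 = c1)) ∨
      (c1 = c2 ∧ (i1 + 1 = i2 ∨ i2 + 1 = i1)) := hadj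
  have hd1' : i1 ≤ i := hd1
  have hd2' : ¬ i2 ≤ i := hd2
  obtain rfl : i1 = i := by omega
  obtain rfl : i2 = i1 + 1 := by omega
  have e1 := mem_skewCells.1 (Finset.mem_coe.1 hc1)
  have e2 := mem_skewCells.1 (Finset.mem_coe.1 hc2)
  simp only at e1 e2
  by_contra hcon
  have a1 := μ.rowLen_anti i1 (i1 + 1) (by omega)
  have a2 := ν.rowLen_anti i1 (i1 + 1) (by omega)
  refine hsq i1 (μ.rowLen i1) ⟨?_, ?_, ?_, ?_⟩ <;> refine mem_skewCells.2 ⟨?_, ?_⟩ <;>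
    simp only <;> omega

/-! ### Rim hooks as moves of beta numbers -/

theorem betaNumber_strictAnti (k : ℕ) (μ : YoungDiagram) : StrictAnti (betaNumber k μ) := by
  intro a b hab
  have h1 : (a : ℕ) < b := hab
  have := μ.rowLen_anti a b h1.le
  simp only [betaNumber]
  omega

theorem eq_of_range_betaNumber_eq {k : ℕ} {μ ν : YoungDiagram} (hμ : μ.rowLen k = 0)
    (hν : ν.rowLen k = 0) (h : Set.range (betaNumber k μ) = Set.range (betaNumber k ν)) :
    μ = ν := by
  have h1 := (StrictAnti.range_inj (betaNumber_strictAnti k μ) (betaNumber_strictAnti k ν)).1 h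
  refine eq_of_rowLen_eq fun i => ?_
  by_cases hi : i < k
  · have := congrFun h1 ⟨i, hi⟩
    simp only [betaNumber] at this
    omega
  · have e1 := μ.rowLen_anti k i (not_lt.1 hi)
    have e2 := ν.rowLen_anti k i (not_lt.1 hi)
    omega

/-- The condition `ν_{i+1} = μ_i + 1` says that beta numbers shift down by one position inside the
strip; the lost value at `j` is replaced by a new one at `p`. -/
theorem IsStrip.betaNumber_comp_cycleIcc {k : ℕ} {μ ν : YoungDiagram} {p j : Fin k}
    (h : IsStrip μ ν p j) :
    betaNumber k ν ∘ Fin.cycleIcc p j = Function.update (betaNumber k μ) j (betaNumber k ν p) := by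
  have hpj : p ≤ j := h.le
  have : NeZero k := ⟨by have := p.2; omega⟩
  funext i
  rw [Function.comp]
  rcases lt_trichotomy i j with hij | rfl | hij
  · rw [Function.update_of_ne hij.ne]
    by_cases hip : i < p
    · rw [Fin.cycleIcc_of_lt hip, betaNumber, betaNumber, h.above i hip]
    · have hpi : p ≤ i := not_lt.1 hip
      have hlt : (i : ℕ) < j := hij
      have hv : ((i + 1 : Fin k) : ℕ) = i + 1 := Fin.val_add_one_of_lt' (by omega)
      rw [Fin.cycleIcc_of_ge_of_lt hpi hij, betaNumber, betaNumber, hv, h.step i hpi hlt]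
      omega
  · rw [Function.update_self, Fin.cycleIcc_of_last hpj]
  · rw [Function.update_of_ne hij.ne', Fin.cycleIcc_of_gt hij, betaNumber, betaNumber,
      h.below i hij]

/-- Adding a rim hook with `r` boxes means adding `r` to one beta number. -/
theorem IsRimHook.exists_betaNumber_eq {k r : ℕ} {μ ν : YoungDiagram} (h : IsRimHook μ ν)
    (hν : ν.rowLen k = 0) (hr : (skewCells μ ν).card = r) :
    ∃ (j : Fin k) (σ : Perm (Fin k)),
      betaNumber k ν ∘ σ = Function.update (betaNumber k μ) j (betaNumber k μ j + r) ∧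
      (Perm.sign σ : ℤ) = (-1) ^ rimHookHeight μ ν := by
  obtain ⟨p, j, hs⟩ := h.exists_isStrip
  have hj : j < k := by
    by_contra hcon
    have h1 := hs.lt hs.le le_rfl
    have h2 := ν.rowLen_anti k j (not_lt.1 hcon)
    omega
  have hp : p < k := lt_of_le_of_lt hs.le hj
  have hμ : μ.rowLen k = 0 := by
    have := le_iff_rowLen_le.1 h.1 k
    omega
  have hs' : IsStrip μ ν (⟨p, hp⟩ : Fin k) (⟨j, hj⟩ : Fin k) := hs
  have hc := hs'.betaNumber_comp_cycleIcc
  have hsum := sum_betaNumber_add_card hμ hν h.1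
  refine ⟨⟨j, hj⟩, Fin.cycleIcc ⟨p, hp⟩ ⟨j, hj⟩, ?_, ?_⟩
  · rw [hc]
    congr 1
    -- The new value is found by comparing sums: all other entries agree, and the total grows by
    -- `r`.
    rw [hr, ← Equiv.sum_comp (Fin.cycleIcc (⟨p, hp⟩ : Fin k) ⟨j, hj⟩) (betaNumber k ν),
      ← sum_update_add _ ⟨j, hj⟩] at hsum
    have h1 : ∑ i, Function.update (betaNumber k μ) ⟨j, hj⟩ (betaNumber k μ ⟨j, hj⟩ + r) i =
      ∑ i, Function.update (betaNumber k μ) ⟨j, hj⟩ (betaNumber k ν ⟨p, hp⟩) i := by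
      rw [hsum, ← hc]; rfl
    rw [← Finset.add_sum_erase _ _ (Finset.mem_univ (⟨j, hj⟩ : Fin k)),
      ← Finset.add_sum_erase (a := (⟨j, hj⟩ : Fin k)) (s := Finset.univ)
        (f := Function.update (betaNumber k μ) ⟨j, hj⟩ (betaNumber k ν ⟨p, hp⟩))
        (Finset.mem_univ _), Function.update_self, Function.update_self] at h1
    have h2 : ∀ x y, ∑ i ∈ Finset.univ.erase (⟨j, hj⟩ : Fin k),
        Function.update (betaNumber k μ) ⟨j, hj⟩ x i =
      ∑ i ∈ Finset.univ.erase (⟨j, hj⟩ : Fin k),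
        Function.update (betaNumber k μ) ⟨j, hj⟩ y i := fun x y =>
      Finset.sum_congr rfl fun i hi => by
        rw [Function.update_of_ne (Finset.ne_of_mem_erase hi),
          Function.update_of_ne (Finset.ne_of_mem_erase hi)]
    have h3 := h2 (betaNumber k μ ⟨j, hj⟩ + r) (betaNumber k ν ⟨p, hp⟩)
    omega
  · rw [Fin.sign_cycleIcc_of_le (Fin.le_def.2 hs.le), hs.rimHookHeight_eq]
    push_cast
    rfl

theorem exists_isRimHook_of_injective {k r : ℕ} (hr : 1 ≤ r) {μ : YoungDiagram}
    (hμ : μ.rowLen k = 0) (j : Fin k)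
    (hinj : Function.Injective
      (Function.update (betaNumber k μ) j (betaNumber k μ j + r))) :
    ∃ ν : YoungDiagram, ν.rowLen k = 0 ∧ IsRimHook μ ν ∧ (skewCells μ ν).card = r ∧
      ∃ σ : Perm (Fin k),
        betaNumber k ν ∘ σ = Function.update (betaNumber k μ) j (betaNumber k μ j + r) := by
  set b := betaNumber k μ j + r with hb
  -- The enlarged beta number `b` is to be sorted in at `p`, the first position whose entry lies
  -- below `b`; injectivity makes all earlier entries strictly larger.
  obtain ⟨p, hp, hmin⟩ := WellFounded.has_min (wellFounded_lt (α := Fin k))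
    {p | betaNumber k μ p < b} ⟨j, by simp only [Set.mem_ofPred_eq]; omega⟩
  have hpj : (p : ℕ) ≤ j := by
    by_contra hcon
    exact hmin j (by simp only [Set.mem_ofPred_eq]; omega) (Fin.lt_def.2 (not_le.1 hcon))
  have hp1 : μ.rowLen p + (k - 1 - p) < b := hp
  have hj2 := j.2
  have habove : ∀ i : ℕ, i < p → b < μ.rowLen i + (k - 1 - i) := by
    intro i hi
    have hik : i < k := by omega
    have h1 : b ≤ betaNumber k μ ⟨i, hik⟩ := not_lt.1 fun hlt => hmin ⟨i, hik⟩ hlt hi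
    have hne : (⟨i, hik⟩ : Fin k) ≠ j := fun he => by
      have := congrArg Fin.val he
      simp only at this
      omega
    refine lt_of_le_of_ne h1 fun he => hne ?_
    apply hinj
    rw [Function.update_self, Function.update_of_ne hne]
    exact he.symm
  set g : ℕ → ℕ := fun i => if i < p then μ.rowLen i else if i = p then b - (k - 1 - p)
    else if i ≤ j then μ.rowLen (i - 1) + 1 else μ.rowLen i with hg
  have hganti : Antitone g := by
    refine antitone_nat_of_succ_le fun i => ?_
    have a1 := μ.rowLen_anti i (i + 1) (by omega)
    have a2 := μ.rowLen_anti (i - 1) i (by omega)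
    have a3 := habove i
    simp only [hg, Nat.add_sub_cancel]
    rcases lt_trichotomy i p with hip | hip | hip
    · have a3 := habove i hip
      split_ifs <;> omega
    · subst hip
      split_ifs <;> omega
    · split_ifs <;> omega
  have hgk : g k = 0 := by
    simp only [hg]
    rw [if_neg (by omega), if_neg (by omega), if_neg (by omega), hμ]
  have hrow := rowLen_ofRowLenFun hganti hgk
  set ν := ofRowLenFun g hganti k
  have hs : IsStrip μ ν p j := by
    refine ⟨hpj, fun i hi => ?_, ?_, fun i hi hi' => ?_, fun i hi => ?_⟩ <;> rw [hrow] <;>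
      simp only [hg]
    · rw [if_pos hi]
    · rw [if_neg (lt_irrefl _), if_pos trivial]
      omega
    · rw [if_neg (by omega), if_neg (by omega), if_pos (by omega), Nat.add_sub_cancel]
    · rw [if_neg (by omega), if_neg (by omega), if_neg (by omega)]
  have hνk : ν.rowLen k = 0 := by rw [hrow, hgk]
  have hβ : betaNumber k ν p = b := by
    rw [betaNumber, hrow]
    simp only [hg]
    rw [if_neg (lt_irrefl _), if_pos trivial]
    omega
  have hc := hs.betaNumber_comp_cycleIcc
  rw [hβ] at hc
  refine ⟨ν, hνk, hs.isRimHook, ?_, _, hc⟩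
  have h1 := sum_betaNumber_add_card hμ hνk hs.subset
  have h2 := sum_update_add (betaNumber k μ) j r
  rw [← hb, ← hc] at h2
  have h3 := Equiv.sum_comp (Fin.cycleIcc p j) (betaNumber k ν)
  simp only [Function.comp] at h2
  omega

/-! ### The sign of sorting by residue and size -/

/-- Comparison of natural numbers by residue modulo `r` first, and by size second. -/
def residueLT (r x y : ℕ) : Prop := x % r < y % r ∨ (x % r = y % r ∧ x < y)

instance (r x y : ℕ) : Decidable (residueLT r x y) := by unfold residueLT; infer_instance

/-- The sign of the comparison of two numbers by residue and size. -/
def residueSign (r x y : ℕ) : ℤ := if residueLT r x y then 1 else if residueLT r y x then -1 else 0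

theorem residueSign_neg (r x y : ℕ) : residueSign r x y = - residueSign r y x := by
  have h : ¬ (residueLT r x y ∧ residueLT r y x) := by unfold residueLT; omega
  unfold residueSign
  split_ifs <;> simp_all

theorem residueSign_mul_self {r x y : ℕ} (hxy : x ≠ y) :
    residueSign r x y * residueSign r x y = 1 := by
  have h : residueLT r x y ∨ residueLT r y x := by unfold residueLT; omega
  unfold residueSign
  split_ifs <;> simp_all

theorem lt_add_iff_of_mod_eq {r x y : ℕ} (h : x % r = y % r) (hxy : x ≠ y) :
    x < y + r ↔ x < y := by
  refine ⟨fun hlt => ?_, fun hlt => by omega⟩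
  by_contra hcon
  have h1 : (x - y) % r = 0 := Nat.sub_mod_eq_zero_of_mod_eq h
  rw [Nat.mod_eq_of_lt (by omega)] at h1
  omega

/-- The residue of `y` is kept, and no number of that residue class lies strictly between `y` and `y
+ r`. -/
theorem residueSign_add {r x y : ℕ} (hxy : x ≠ y) (hxy' : x ≠ y + r) :
    residueSign r x (y + r) = residueSign r x y := by
  have h1 : residueLT r x (y + r) ↔ residueLT r x y := by
    unfold residueLT
    rw [Nat.add_mod_right]
    exact or_congr Iff.rfl (and_congr_right fun h => lt_add_iff_of_mod_eq h hxy)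
  have h2 : residueLT r (y + r) x ↔ residueLT r y x := by
    unfold residueLT
    rw [Nat.add_mod_right]
    refine or_congr Iff.rfl (and_congr_right fun h => ?_)
    have := lt_add_iff_of_mod_eq h.symm hxy
    omega
  unfold residueSign
  simp only [h1, h2]

/-- The sign of the permutation that sorts `μ` by residue modulo `r` and size. -/
def sortSign {k : ℕ} (r : ℕ) (μ : Fin k → ℕ) : ℤ :=
  ∏ j, ∏ i ∈ Finset.Iio j, residueSign r (μ i) (μ j)

theorem sortSign_comp {k : ℕ} (r : ℕ) (μ : Fin k → ℕ) (σ : Perm (Fin k)) :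
    sortSign r (μ ∘ σ) = Perm.sign σ * sortSign r μ := by
  have h := σ.prod_Iio_comp_eq_sign_mul_prod
    (f := fun i j => residueSign r (μ i) (μ j)) fun i j => residueSign_neg r _ _
  simpa [sortSign] using h

theorem sortSign_mul_self {k : ℕ} (r : ℕ) {μ : Fin k → ℕ} (h : Function.Injective μ) :
    sortSign r μ * sortSign r μ = 1 := by
  rw [sortSign, ← Finset.prod_mul_distrib]
  refine Finset.prod_eq_one fun j _ => ?_
  rw [← Finset.prod_mul_distrib]
  exact Finset.prod_eq_one fun i hi =>
    residueSign_mul_self fun he => (Finset.mem_Iio.1 hi).ne (h he)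

theorem sortSign_update {k r : ℕ} {μ : Fin k → ℕ} (h : Function.Injective μ) {j : Fin k}
    (h' : Function.Injective (Function.update μ j (μ j + r))) :
    sortSign r (Function.update μ j (μ j + r)) = sortSign r μ := by
  have hne : ∀ i, i ≠ j → μ i ≠ μ j + r := by
    intro i hi he
    apply hi
    apply h'
    rw [Function.update_self, Function.update_of_ne hi, he]
  have key : ∀ i, i ≠ j → residueSign r (μ i) (μ j + r) = residueSign r (μ i) (μ j) :=
    fun i hi => residueSign_add (fun he => hi (h he)) (hne i hi)
  refine Finset.prod_congr rfl fun b _ => Finset.prod_congr rfl fun a ha => ?_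
  have hab := (Finset.mem_Iio.1 ha).ne
  by_cases hb : b = j
  · subst hb
    rw [Function.update_self, Function.update_of_ne hab, key a hab]
  · rw [Function.update_of_ne hb]
    by_cases haj : a = j
    · subst haj
      rw [Function.update_self, residueSign_neg, key b hb, ← residueSign_neg]
    · rw [Function.update_of_ne haj]

/-! ### Signed path counts and rim hook tableaux -/

theorem signedPathCount_zero_self {k : ℕ} (r : ℕ) {B : Fin k → ℕ} (hB : Function.Injective B) :
    signedPathCount r B 0 B = 1 := by
  rw [signedPathCount, Finset.sum_eq_single 1]
  · simp
  · intro σ _ hσ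
    exact if_neg fun he => hσ (Equiv.ext fun i => hB (congrFun he i).symm)
  · simp

theorem signedPathCount_comp {k : ℕ} (r : ℕ) (B : Fin k → ℕ) (d : ℕ) (μ : Fin k → ℕ)
    (τ : Perm (Fin k)) :
    signedPathCount r B d (μ ∘ τ) = Perm.sign τ * signedPathCount r B d μ := by
  induction d generalizing μ with
  | zero =>
    rw [signedPathCount, signedPathCount, ← Equiv.sum_comp (Equiv.mulRight τ), Finset.mul_sum]
    refine Finset.sum_congr rfl fun σ _ => ?_
    have : μ ∘ τ = B ∘ (σ * τ : Perm (Fin k)) ↔ μ = B ∘ σ := by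
      rw [Perm.coe_mul, ← Function.comp_assoc]
      exact τ.surjective.injective_comp_right.eq_iff
    simp only [Equiv.coe_mulRight, this]
    split_ifs
    · rw [Perm.sign_mul]
      push_cast
      ring
    · simp
  | succ d ih =>
    rw [signedPathCount, signedPathCount, Finset.mul_sum]
    refine Eq.trans ?_ (Equiv.sum_comp τ _)
    refine Finset.sum_congr rfl fun j _ => ?_
    rw [← ih, Function.comp_apply, ← Function.update_comp_eq_of_injective _ τ.injective]

/-- Exchanging two equal entries fixes `μ` but changes the sign of the count. -/
theorem signedPathCount_of_not_injective {k : ℕ} (r : ℕ) (B : Fin k → ℕ) (d : ℕ) {μ : Fin k → ℕ}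
    (h : ¬ Function.Injective μ) : signedPathCount r B d μ = 0 := by
  simp only [Function.Injective, not_forall] at h
  obtain ⟨i, j, he, hij⟩ := h
  have h1 := signedPathCount_comp r B d μ (swap i j)
  have h2 : μ ∘ swap i j = μ := by
    funext x
    simp only [Function.comp, swap_apply_def]
    split_ifs <;> simp_all
  rw [h2, Perm.sign_swap hij] at h1
  push_cast at h1
  omega

theorem mem_RHT_succ {r d : ℕ} {μ ν : YoungDiagram} {T : Fin (d + 1 + 1) → YoungDiagram} :
    T ∈ RHT r (d + 1) μ ν ↔ T 0 = μ ∧ IsRimHook μ (T 1) ∧ (skewCells μ (T 1)).card = r ∧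
      Fin.tail T ∈ RHT r d (T 1) ν := by
  simp only [RHT, Set.mem_ofPred_eq, Fin.forall_fin_succ, Fin.tail, Fin.castSucc_zero,
    Fin.succ_zero_eq_one, Fin.succ_last, Fin.succ_castSucc]
  constructor
  · rintro ⟨rfl, h1, ⟨h2, h3⟩, h4⟩
    exact ⟨rfl, h2, h3, trivial, h1, h4⟩
  · rintro ⟨rfl, h2, h3, -, h1, h4⟩
    exact ⟨rfl, h1, ⟨h2, h3⟩, h4⟩

theorem le_of_mem_RHT {r d : ℕ} {μ ν : YoungDiagram} {T : Fin (d + 1) → YoungDiagram}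
    (hT : T ∈ RHT r d μ ν) : μ ≤ ν := by
  induction d generalizing μ with
  | zero => exact (hT.1.symm.trans hT.2.1).le
  | succ d ih =>
    obtain ⟨-, h1, -, h2⟩ := mem_RHT_succ.1 hT
    exact h1.1.trans (ih h2)

theorem rowLen_eq_zero_of_le {k : ℕ} {μ ν : YoungDiagram} (h : μ ≤ ν) (hν : ν.rowLen k = 0) :
    μ.rowLen k = 0 := by
  have := le_iff_rowLen_le.1 h k
  omega

/-- Adding `r` to an entry keeps the sorting sign, so a rim hook changes it only through the
re-sorting cycle, whose sign is `(-1)^ht`. The product telescopes along `T`. -/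
theorem neg_one_pow_tableauHeight {k r d : ℕ} {μ ν : YoungDiagram} (hν : ν.rowLen k = 0)
    {T : Fin (d + 1) → YoungDiagram} (hT : T ∈ RHT r d μ ν) :
    (-1 : ℤ) ^ tableauHeight T =
      sortSign r (betaNumber k μ) * sortSign r (betaNumber k ν) := by
  induction d generalizing μ with
  | zero =>
    obtain rfl : μ = ν := hT.1.symm.trans hT.2.1
    rw [sortSign_mul_self r (betaNumber_strictAnti k μ).injective]
    simp [tableauHeight]
  | succ d ih =>
    obtain ⟨rfl, h1, h2, h3⟩ := mem_RHT_succ.1 hT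
    have hT1 : (T 1).rowLen k = 0 := rowLen_eq_zero_of_le (le_of_mem_RHT h3) hν
    have hh : tableauHeight T = rimHookHeight (T 0) (T 1) + tableauHeight (Fin.tail T) := by
      rw [tableauHeight, Fin.sum_univ_succ]
      rfl
    obtain ⟨j, σ, hσ, hsign⟩ := h1.exists_betaNumber_eq hT1 h2
    have hinj := (betaNumber_strictAnti k (T 1)).injective.comp σ.injective
    have h4 := sortSign_comp r (betaNumber k (T 1)) σ
    rw [hσ] at hinj
    rw [hσ, sortSign_update (betaNumber_strictAnti k (T 0)).injective hinj] at h4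
    rw [hh, pow_add, ih h3, ← hsign, h4, mul_assoc]

theorem image_cons_RHT_subset {r d : ℕ} {μ μ' ν : YoungDiagram} (h : IsRimHook μ μ')
    (hr : (skewCells μ μ').card = r) :
    (fun T : Fin (d + 1) → YoungDiagram => (Fin.cons μ T : Fin (d + 1 + 1) → YoungDiagram)) ''
      RHT r d μ' ν ⊆ RHT r (d + 1) μ ν := by
  rintro _ ⟨T, hT, rfl⟩
  rw [mem_RHT_succ]
  have h1 : (Fin.cons μ T : Fin (d + 1 + 1) → YoungDiagram) 1 = μ' := hT.1
  simp only [h1, Fin.tail_cons]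
  exact ⟨rfl, h, hr, hT⟩

/-- Induction on the first rim hook: the moves without collision correspond bijectively to the rim
hooks that can be added, and the colliding moves count zero. -/
theorem finite_RHT_and_signedPathCount_eq {k r : ℕ} (hr : 1 ≤ r) (d : ℕ) {μ ν : YoungDiagram}
    (hμ : μ.rowLen k = 0) (hν : ν.rowLen k = 0) :
    (RHT r d μ ν).Finite ∧ signedPathCount r (betaNumber k ν) d (betaNumber k μ) =
      sortSign r (betaNumber k μ) * sortSign r (betaNumber k ν) * ((RHT r d μ ν).ncard : ℤ) := by
  classical
  induction d generalizing μ with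
  | zero =>
    by_cases hμν : μ = ν
    · subst hμν
      have hR : RHT r 0 μ μ = {fun _ => μ} := by
        ext T
        simp only [RHT, Set.mem_ofPred_eq, Set.mem_singleton_iff]
        constructor
        · rintro ⟨h, -⟩
          funext i
          obtain rfl : i = 0 := Fin.ext (by omega)
          exact h
        · rintro rfl
          exact ⟨rfl, rfl, fun i => i.elim0⟩
      have hinj := (betaNumber_strictAnti k μ).injective
      refine ⟨by rw [hR]; exact Set.finite_singleton _, ?_⟩
      rw [hR, Set.ncard_singleton, sortSign_mul_self r hinj, signedPathCount_zero_self r hinj,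
        Nat.cast_one, mul_one]
    · have hR : RHT r 0 μ ν = ∅ := by
        refine Set.eq_empty_of_forall_notMem fun T hT => hμν (hT.1.symm.trans hT.2.1)
      rw [hR]
      refine ⟨Set.finite_empty, ?_⟩
      rw [Set.ncard_empty, Nat.cast_zero, mul_zero, signedPathCount]
      refine Finset.sum_eq_zero fun σ _ => if_neg fun he => hμν ?_
      refine eq_of_range_betaNumber_eq hμ hν ?_
      rw [he, Set.range_comp, σ.surjective.range_eq, Set.image_univ]
  | succ d ih =>
    set β := betaNumber k μ with hβ
    have hβinj : Function.Injective β := (betaNumber_strictAnti k μ).injective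
    set J := Finset.univ.filter fun j : Fin k =>
      Function.Injective (Function.update β j (β j + r)) with hJ
    have hex : ∀ j ∈ J, ∃ μ' : YoungDiagram, μ'.rowLen k = 0 ∧ IsRimHook μ μ' ∧
        (skewCells μ μ').card = r ∧ ∃ σ : Perm (Fin k),
          betaNumber k μ' ∘ σ = Function.update β j (β j + r) := fun j hj =>
      exists_isRimHook_of_injective hr hμ j (Finset.mem_filter.1 hj).2
    choose! f hf1 hf2 hf3 σ hσ using hex
    have hrange : ∀ j ∈ J, Set.range (betaNumber k (f j)) =
        Set.range (Function.update β j (β j + r)) := fun j hj => by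
      rw [← hσ j hj, Set.range_comp, (σ j).surjective.range_eq, Set.image_univ]
    have hfinj : ∀ i ∈ J, ∀ j ∈ J, f i = f j → i = j := by
      intro i hi j hj he
      by_contra hij
      -- A move at `i ≠ j` keeps the value `β j`, whereas the move at `j` removes it.
      have h1 : β j ∈ Set.range (Function.update β i (β i + r)) :=
        ⟨j, Function.update_of_ne (Ne.symm hij) _ _⟩
      rw [← hrange i hi, he, hrange j hj] at h1
      obtain ⟨x, hx⟩ := h1
      by_cases hxj : x = j
      · subst hxj
        rw [Function.update_self] at hx
        omega
      · rw [Function.update_of_ne hxj] at hx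
        exact hxj (hβinj hx)
    set cons : (Fin (d + 1) → YoungDiagram) → (Fin (d + 1 + 1) → YoungDiagram) :=
      fun T => Fin.cons μ T with hcons
    have hcinj : Function.Injective cons :=
      Fin.cons_right_injective (α := fun _ => YoungDiagram) μ
    have hunion : RHT r (d + 1) μ ν = ⋃ j ∈ (J : Set (Fin k)), cons '' RHT r d (f j) ν := by
      refine Set.Subset.antisymm ?_ (Set.iUnion₂_subset fun j hj =>
        image_cons_RHT_subset (hf2 j hj) (hf3 j hj))
      intro T hT
      obtain ⟨h0, h1, h2, h3⟩ := mem_RHT_succ.1 hT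
      have hT1 : (T 1).rowLen k = 0 := rowLen_eq_zero_of_le (le_of_mem_RHT h3) hν
      obtain ⟨j, τ, hτ, -⟩ := h1.exists_betaNumber_eq hT1 h2
      have hj : j ∈ J := by
        refine Finset.mem_filter.2 ⟨Finset.mem_univ j, ?_⟩
        rw [← hτ]
        exact (betaNumber_strictAnti k (T 1)).injective.comp τ.injective
      have hTf : T 1 = f j := by
        refine eq_of_range_betaNumber_eq hT1 (hf1 j hj) ?_
        rw [hrange j hj, ← hτ, Set.range_comp, τ.surjective.range_eq, Set.image_univ]
      refine Set.mem_iUnion₂.2 ⟨j, hj, Fin.tail T, hTf ▸ h3, ?_⟩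
      rw [hcons, ← h0]
      exact Fin.cons_self_tail T
    have hfin : ∀ j ∈ (J : Set (Fin k)), (cons '' RHT r d (f j) ν).Finite := fun j hj =>
      (ih (hf1 j hj)).1.image _
    refine ⟨?_, ?_⟩
    · rw [hunion]
      exact J.finite_toSet.biUnion hfin
    · have hdisj : (J : Set (Fin k)).PairwiseDisjoint fun j => cons '' RHT r d (f j) ν := by
        intro i hi j hj hij
        refine Set.disjoint_left.2 ?_
        rintro _ ⟨T, hT, rfl⟩ ⟨T', hT', he⟩
        obtain rfl := hcinj he
        exact hij (hfinj i hi j hj (hT.1.symm.trans hT'.1))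
      have hcard : (RHT r (d + 1) μ ν).ncard = ∑ j ∈ J, (RHT r d (f j) ν).ncard := by
        rw [hunion, J.finite_toSet.ncard_biUnion hfin hdisj, finsum_mem_coe_finset]
        exact Finset.sum_congr rfl fun j _ => Set.ncard_image_of_injective _ hcinj
      rw [hcard, Nat.cast_sum, Finset.mul_sum, signedPathCount,
        ← Finset.sum_subset (Finset.subset_univ J)]
      · refine Finset.sum_congr rfl fun j hj => ?_
        rw [← sortSign_update hβinj (Finset.mem_filter.1 hj).2, ← hσ j hj, signedPathCount_comp,
          (ih (hf1 j hj)).2, sortSign_comp]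
        ring
      · intro j _ hj
        refine signedPathCount_of_not_injective _ _ _ fun h => hj ?_
        exact Finset.mem_filter.2 ⟨Finset.mem_univ j, h⟩

/-! ### Assembly -/

theorem BoxPartition.rowLen_eq_zero {k n : ℕ} (μ : BoxPartition k n) : μ.1.rowLen k = 0 := by
  by_contra h
  have hmem : (k, 0) ∈ μ.1 := YoungDiagram.mem_iff_lt_rowLen.2 (Nat.pos_of_ne_zero h)
  exact lt_irrefl k (μ.2 _ hmem).1

theorem skewSign_eq {k r d : ℕ} {μ ν : YoungDiagram} (hν : ν.rowLen k = 0)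
    (h : (RHT r d μ ν).Nonempty) :
    skewSign r d μ ν = sortSign r (betaNumber k μ) * sortSign r (betaNumber k ν) := by
  rw [skewSign, dif_pos h]
  exact neg_one_pow_tableauHeight hν h.some_mem

theorem signedPathCount_betaNumber {k r : ℕ} (hr : 1 ≤ r) (d : ℕ) {μ ν : YoungDiagram}
    (hμ : μ.rowLen k = 0) (hν : ν.rowLen k = 0) :
    signedPathCount r (betaNumber k ν) d (betaNumber k μ) =
      skewSign r d μ ν * ((RHT r d μ ν).ncard : ℤ) := by
  rw [(finite_RHT_and_signedPathCount_eq hr d hμ hν).2]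
  rcases (RHT r d μ ν).eq_empty_or_nonempty with h | h
  · simp [h]
  · rw [skewSign_eq hν h]

theorem algebraMap_localizedPoly {k n : ℕ} (μ ν : BoxPartition k n) :
    algebraMap (Polynomial ℚ) (RatFunc ℚ) (localizedPoly μ ν) =
      schubertValue (fun i : Fin n => (RatFunc.X : RatFunc ℚ) ^ ((i : ℕ) + 1))
        (grassmannianPerm μ) (grassmannianPerm ν) := by
  have h : (IsScalarTower.toAlgHom ℚ (Polynomial ℚ) (RatFunc ℚ)).comp
      ((MvPolynomial.aeval fun i : Fin n => (Polynomial.X : Polynomial ℚ) ^ ((i : ℕ) + 1)).comp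
        (substPerm (grassmannianPerm ν))) =
      MvPolynomial.aeval (Sum.elim (fun i : Fin n => (RatFunc.X : RatFunc ℚ) ^
        ((grassmannianPerm ν i : ℕ) + 1)) fun i : Fin n => RatFunc.X ^ ((i : ℕ) + 1)) := by
    apply MvPolynomial.algHom_ext
    rintro (i | i) <;> simp [substPerm]
  exact DFunLike.congr_fun h (doubleSchubert (grassmannianPerm μ))

theorem hasVal_C (ζ : ℂ) (c : ℚ) : HasVal ζ (RatFunc.C c) c := by
  have := hasVal_algebraMap ζ (Polynomial.C c)
  rwa [RatFunc.algebraMap_C, Polynomial.aeval_C, eq_ratCast (algebraMap ℚ ℂ)] at this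

end RimHook

theorem mainTheorem10 (n k r d : ℕ) (hk : 1 ≤ k) (hkn : k ≤ n) (hr : 1 ≤ r) (hd : 1 ≤ d)
    (lam Lam : RimHook.BoxPartition k n) (hle : lam.1 ≤ Lam.1)
    (hsize : (RimHook.skewCells lam.1 Lam.1).card = r * d) :
    (∀ T ∈ RimHook.RHT r d lam.1 Lam.1,
      (-1 : ℤ) ^ RimHook.tableauHeight T = RimHook.skewSign r d lam.1 Lam.1) ∧
    RimHook.localizedPoly Lam Lam ≠ 0 ∧
    ∃ g : RatFunc ℚ, RimHook.IsLittleO r g ∧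
      algebraMap (Polynomial ℚ) (RatFunc ℚ) (RimHook.localizedPoly lam Lam) /
          algebraMap (Polynomial ℚ) (RatFunc ℚ) (RimHook.localizedPoly Lam Lam) =
        1 / ((RatFunc.X : RatFunc ℚ) ^ r - 1) ^ d *
          (RatFunc.C ((RimHook.skewSign r d lam.1 Lam.1 : ℚ) *
              ((RimHook.RHT r d lam.1 Lam.1).ncard : ℚ) /
                ((r : ℚ) ^ d * (Nat.factorial d : ℚ))) + g) := by
  have hlam := lam.rowLen_eq_zero
  have hLam := Lam.rowLen_eq_zero
  set β := RimHook.betaNumber k Lam.1 with hβ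
  set D := ∏ i, RimHook.newton (fun j => (RatFunc.X : RatFunc ℚ) ^ (j + 1))
    (RatFunc.X ^ (β i + 1)) (β i)
  have hD : D ≠ 0 := RimHook.prod_newton_self_ne_zero β
  have hy : Function.Injective fun i : Fin n => (RatFunc.X : RatFunc ℚ) ^ ((i : ℕ) + 1) := by
    intro a b h
    have := RimHook.ratFunc_X_pow_injective h
    exact Fin.ext (by omega)
  obtain ⟨V, hV⟩ := RimHook.exists_schubertValue_mul_eq_det hkn
    (y := fun j => (RatFunc.X : RatFunc ℚ) ^ (j + 1)) hy Lam
  have hVlam := hV lam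
  have hVLam := hV Lam
  rw [← RimHook.algebraMap_localizedPoly] at hVlam hVLam
  change _ = RimHook.alternant _ β _ at hVlam
  change _ = RimHook.alternant _ β β at hVLam
  rw [RimHook.alternant_of_sum_eq _ r rfl, RimHook.signedPathCount_zero_self r
    (RimHook.betaNumber_strictAnti k Lam.1).injective, Int.cast_one, one_mul] at hVLam
  change _ = D at hVLam
  -- Since the product is `D ≠ 0`, both the localized class at `Λ` and the common factor `V` are
  -- nonzero.
  have hne := left_ne_zero_of_mul (hVLam ▸ hD)
  have hV0 := right_ne_zero_of_mul (hVLam ▸ hD)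
  refine ⟨fun T hT => ?_, fun h => hne (by rw [h, map_zero]), ?_⟩
  · rw [RimHook.skewSign_eq hLam ⟨T, hT⟩, RimHook.neg_one_pow_tableauHeight hLam hT]
  have hratio : algebraMap (Polynomial ℚ) (RatFunc ℚ) (RimHook.localizedPoly lam Lam) /
      algebraMap (Polynomial ℚ) (RatFunc ℚ) (RimHook.localizedPoly Lam Lam) =
      RimHook.alternant (fun j => RatFunc.X ^ (j + 1)) β (RimHook.betaNumber k lam.1) / D := by
    rw [← hVlam, ← hVLam, mul_div_mul_right _ _ hV0]
  have hw := pow_ne_zero d (RimHook.X_pow_sub_one_ne_zero hr)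
  set F := RimHook.alternant (fun j => (RatFunc.X : RatFunc ℚ) ^ (j + 1)) β
    (RimHook.betaNumber k lam.1) / D
  set q : ℚ := (RimHook.skewSign r d lam.1 Lam.1 : ℚ) *
    ((RimHook.RHT r d lam.1 Lam.1).ncard : ℚ) / ((r : ℚ) ^ d * (Nat.factorial d : ℚ)) with hq
  -- The error term is forced by the identity; it remains to see that it has value zero at each `ζ`.
  refine ⟨(RatFunc.X ^ r - 1) ^ d * F - RatFunc.C q, RimHook.isLittleO_of_hasVal fun ζ hζ => ?_, ?_⟩
  · have hsum := RimHook.sum_betaNumber_add_card hlam hLam hle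
    rw [hsize] at hsum
    obtain ⟨c, hc, hcd⟩ := RimHook.exists_hasVal_alternant hr hζ β (r * d)
      (RimHook.betaNumber k lam.1) hsum
    rw [Nat.mul_div_cancel_left d hr] at hc
    have hcq : c = q := by
      have h0 : (r : ℂ) ^ d * (d.factorial : ℂ) ≠ 0 :=
        mul_ne_zero (pow_ne_zero _ (Nat.cast_ne_zero.2 (by omega)))
          (Nat.cast_ne_zero.2 d.factorial_ne_zero)
      rw [hq, eq_comm]
      push_cast
      rw [div_eq_iff h0, hcd d rfl, RimHook.signedPathCount_betaNumber hr d hlam hLam]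
      push_cast
      rfl
    have := hc.sub (RimHook.hasVal_C ζ q)
    rwa [hcq, sub_self] at this
  · rw [hratio, add_sub_cancel, one_div, inv_mul_cancel_left₀ hw]
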